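/- Let $f:\mathbb{R}^n\to\mathbb{R}^n$ and let $x^*$ be an equilibrium, $f(x^*)=0$. Assume that near $x^*$ the field $f$ is piecewise continuously differentiable (some open neighbourhood $U$ of $x^*$ is covered by finitely many closed sets, and on the part of each of them in $U$ the field $f$ coincides with a function that is $C^1$ on $U$), that $f$ is differentiable at $x^*$ with Jacobian matrix $A=Df(x^*)$, and that $x^*$ is hyperbolic: no eigenvalue of $A$ has zero real part. (In particular $x^*$ may be any unstable hyperbolic equilibrium: saddle, focus or saddle-focus, with any number of positive real eigenvalues.) A *real Jordan decomposition* of $A$ consists of an invertible $V$ and integers $m,p\ge 0$ with $m+2p=n$ such that $A=V^{-1}DV$, $D=\mathrm{diag}(\lambda_1,\dots,\lambda_m,B_1,\dots,B_p)+N$, where $\lambda_i\in\mathbb{R}$, $B_i=\begin{bmatrix}\mu_i&-\omega_i\\ \omega_i&\mu_i\end{bmatrix}$ with $\omega_i\neq0$, and the off-diagonal part $N$ is zero except that two consecutive $1\times1$ blocks with the same eigenvalue may be coupled by a superdiagonal entry $1$, and two consecutive equal blocks $B_i=B_{i+1}$ may be coupled by the superdiagonal block $\begin{bmatrix}1&0\\0&1\end{bmatrix}$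 or $\begin{bmatrix}0&0\\1&0\end{bmatrix}$. Then $A$ has a real Jordan decomposition. Moreover, for every real Jordan decomposition of $A$, every $\tau>0$, all $\zeta_i$ with $|\zeta_i|<1$ ($1\le i\le m$) and all $\rho_i\in[0,1)$, $\theta_i\in[0,2\pi)$ ($1\le i\le p$), the following holds. Let $\widetilde K=\mathrm{diag}(k_1,\dots,k_m,E_1,\dots,E_p)$ (which does not depend on $N$), where $$k_i=\begin{cases}0,&\lambda_i<0,\\[2pt] \dfrac{e^{-\lambda_i\tau}(e^{3\lambda_i\tau}-\zeta_i)}{\tau(e^{\lambda_i\tau}-1)},&\lambda_i>0,\end{cases}\qquad E_i=\begin{cases}0_{2\times2},&\mu_i<0,\\[2pt] \begin{bmatrix}\epsilon_{i1}&-\epsilon_{i2}\\ \epsilon_{i2}&\epsilon_{i1}\end{bmatrix},&\mu_i>0,\end{cases}$$ and, dropping the index $i$ of $\mu,\omega,\rho,\theta$, $$\epsilon_{i1}=\frac{\rho\cos(\theta-\omega\tau)-\rho e^{\mu\tau}\cos(\theta-2\omega\tau)-e^{3\mu\tau}\cos(2\omega\tau)+e^{4\mu\tau}\cos(\omega\tau)}{\tau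 e^{\mu\tau}\left(1-2e^{\mu\tau}\cos(\omega\tau)+e^{2\mu\tau}\right)},$$ $$\epsilon_{i2}=\frac{\rho\sin(\theta-\omega\tau)-\rho e^{\mu\tau}\sin(\theta-2\omega\tau)-e^{3\mu\tau}\sin(2\omega\tau)+e^{4\mu\tau}\sin(\omega\tau)}{\tau e^{\mu\tau}\left(1-2e^{\mu\tau}\cos(\omega\tau)+e^{2\mu\tau}\right)}.$$ Put $K=V^{-1}\widetilde KV$, and for $k=0,1,2,\dots$ let $K(t)=0$ for $3k\tau\le t<(3k+2)\tau$ and $K(t)=K$ for $(3k+2)\tau\le t<(3k+3)\tau$. Then $x^*$ is a locally asymptotically stable equilibrium of the controlled delay equation $$\dot x(t)=f(x(t))+K(t)\big(x(t-2\tau)-x(t-\tau)\big)$$ (solutions are continuous and satisfy the equation with the right derivative). That is: for every $\varepsilon>0$ there is $\delta>0$ such that, for every $t_0\ge0$ and every continuous initial function $\varphi$ on $[t_0-2\tau,t_0]$ with $\|\varphi(s)-x^*\|<\delta$ for all $s$, every solution on an interval $[t_0,T)$ that starts from $\varphi$ satisfies $\|x(t)-x^*\|<\varepsilon$ on it; and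 there is $\delta>0$ such that, for every $t_0\ge 0$ and every such $\varphi$, a solution on $[t_0,\infty)$ exists and every solution on $[t_0,\infty)$ tends to $x^*$ as $t\to\infty$. -/

import Mathlib

open Set Filter Topology

noncomputable section

namespace TDFC

/-- `f` is piecewise continuously differentiable near `x`: on an open neighbourhood `U` of `x`,
covered by finitely many closed pieces, `f` coincides on each piece with a function that is
`C¹` on `U`. (A function that is `C¹` near `x` is the case of a single piece.) -/
def PiecewiseC1At {n : ℕ} (f : (Fin n → ℝ) → (Fin n → ℝ)) (x : Fin n → ℝ) : Prop :=
  ∃ U : Set (Fin n → ℝ), IsOpen U ∧ x ∈ U ∧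
    ∃ (k : ℕ) (C : Fin k → Set (Fin n → ℝ)) (g : Fin k → (Fin n → ℝ) → (Fin n → ℝ)),
      (∀ i, IsClosed (C i)) ∧ U ⊆ ⋃ i, C i ∧
      ∀ i, ContDiffOn ℝ 1 (g i) U ∧ EqOn f (g i) (U ∩ C i)

/-- `A` is the Jacobian matrix of `f` at `x` (and `f` is differentiable there). -/
def IsJacobianAt {n : ℕ} (f : (Fin n → ℝ) → (Fin n → ℝ)) (A : Matrix (Fin n) (Fin n) ℝ)
    (x : Fin n → ℝ) : Prop :=
  HasFDerivAt f (LinearMap.toContinuousLinearMap (Matrix.mulVecLin A)) x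

/-- No complex eigenvalue of the real matrix `A` lies on the imaginary axis. -/
def IsHyperbolic {n : ℕ} (A : Matrix (Fin n) (Fin n) ℝ) : Prop :=
  ∀ z ∈ spectrum ℂ (A.map (algebraMap ℝ ℂ)), z.re ≠ 0

/-! ### Real Jordan form -/

/-- Row and column labels: `m` one-dimensional blocks, then `p` two-dimensional ones. -/
abbrev BlockIndex (m p : ℕ) : Type := Fin m ⊕ (Fin p × Fin 2)

/-- The labels in their natural order: `i ↦ i` and `(i, a) ↦ m + 2 i + a`. -/
def blockEquiv {m p n : ℕ} (h : m + p * 2 = n) : BlockIndex m p ≃ Fin n :=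
  ((Equiv.sumCongr (Equiv.refl (Fin m)) finProdFinEquiv).trans finSumFinEquiv).trans (finCongr h)

/-- The matrix of multiplication by `a + i b` on `ℂ = ℝ²`. -/
def rotBlock (a b : ℝ) : Matrix (Fin 2) (Fin 2) ℝ := !![a, -b; b, a]

/-- The block-diagonal matrix with `1 × 1` blocks `d i` and `2 × 2` blocks `B i`. -/
def blockDiag {m p : ℕ} (d : Fin m → ℝ) (B : Fin p → Matrix (Fin 2) (Fin 2) ℝ) :
    Matrix (BlockIndex m p) (BlockIndex m p) ℝ :=
  Matrix.fromBlocks (Matrix.diagonal d) 0 0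
    (Matrix.of fun r s => if r.1 = s.1 then B r.1 r.2 s.2 else 0)

/-- `N` is the off-diagonal part of a real Jordan matrix with real eigenvalues `lam i` and
non-real eigenvalues `mu i ± i om i`. It couples only consecutive blocks of the same eigenvalue.
Real blocks are coupled by an entry `1`. Two-dimensional blocks are coupled either by the
`2 × 2` identity or by a single `1` on the superdiagonal of the whole matrix; both conventions
for the real Jordan form are in use and both are allowed. -/
def IsJordanOffDiag {m p : ℕ} (lam : Fin m → ℝ) (mu om : Fin p → ℝ)
    (N : Matrix (BlockIndex m p) (BlockIndex m p) ℝ) : Prop :=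
  (∀ i j : Fin m, N (Sum.inl i) (Sum.inl j) = 0 ∨
    ((i : ℕ) + 1 = j ∧ lam i = lam j ∧ N (Sum.inl i) (Sum.inl j) = 1)) ∧
  (∀ (i : Fin m) (r : Fin p × Fin 2), N (Sum.inl i) (Sum.inr r) = 0 ∧
    N (Sum.inr r) (Sum.inl i) = 0) ∧
  (∀ i j : Fin p,
    let S : Matrix (Fin 2) (Fin 2) ℝ := Matrix.of fun a b => N (Sum.inr (i, a)) (Sum.inr (j, b))
    S = 0 ∨ ((i : ℕ) + 1 = j ∧ mu i = mu j ∧ om i = om j ∧ (S = 1 ∨ S = !![0, 0; 1, 0])))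

/-- `A = V⁻¹ D V` with `V` invertible and `D` in real Jordan form, with real eigenvalues `lam i`,
pairs of non-real eigenvalues `mu i ± i om i`, and off-diagonal part `N`. -/
def IsRealJordanDecomposition {m p n : ℕ} (h : m + p * 2 = n) (A V : Matrix (Fin n) (Fin n) ℝ)
    (lam : Fin m → ℝ) (mu om : Fin p → ℝ)
    (N : Matrix (BlockIndex m p) (BlockIndex m p) ℝ) : Prop :=
  IsUnit V ∧ (∀ i, om i ≠ 0) ∧ IsJordanOffDiag lam mu om N ∧
  A = V⁻¹ * Matrix.reindex (blockEquiv h) (blockEquiv h)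
        (blockDiag lam (fun i => rotBlock (mu i) (om i)) + N) * V

/-! ### The gain matrix -/

/-- The gain for a real eigenvalue `lam > 0`. -/
def realGain (tau lam zeta : ℝ) : ℝ :=
  Real.exp (-lam * tau) * (Real.exp (3 * lam * tau) - zeta) /
    (tau * (Real.exp (lam * tau) - 1))

/-- Common denominator of the two gains for a pair `mu ± i om` with `mu > 0`. -/
def complexGainDenom (tau mu om : ℝ) : ℝ :=
  tau * Real.exp (mu * tau) *
    (1 - 2 * Real.exp (mu * tau) * Real.cos (om * tau) + Real.exp (2 * mu * tau))

/-- First gain for a pair `mu ± i om` with `mu > 0`. -/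
def complexGain₁ (tau mu om rho theta : ℝ) : ℝ :=
  (rho * Real.cos (theta - om * tau)
    - rho * Real.exp (mu * tau) * Real.cos (theta - 2 * om * tau)
    - Real.exp (3 * mu * tau) * Real.cos (2 * om * tau)
    + Real.exp (4 * mu * tau) * Real.cos (om * tau)) / complexGainDenom tau mu om

/-- Second gain for a pair `mu ± i om` with `mu > 0`. -/
def complexGain₂ (tau mu om rho theta : ℝ) : ℝ :=
  (rho * Real.sin (theta - om * tau)
    - rho * Real.exp (mu * tau) * Real.sin (theta - 2 * om * tau)
    - Real.exp (3 * mu * tau) * Real.sin (2 * om * tau)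
    + Real.exp (4 * mu * tau) * Real.sin (om * tau)) / complexGainDenom tau mu om

/-- The block-diagonal gain matrix in Jordan coordinates: the blocks of eigenvalues with positive
real part carry the gains above, the other blocks are zero. -/
def gainTilde {m p n : ℕ} (h : m + p * 2 = n) (tau : ℝ) (lam : Fin m → ℝ) (mu om : Fin p → ℝ)
    (zeta : Fin m → ℝ) (rho theta : Fin p → ℝ) : Matrix (Fin n) (Fin n) ℝ :=
  Matrix.reindex (blockEquiv h) (blockEquiv h)
    (blockDiag (fun i => if 0 < lam i then realGain tau (lam i) (zeta i) else 0)
      (fun i => if 0 < mu i then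
          rotBlock (complexGain₁ tau (mu i) (om i) (rho i) (theta i))
            (complexGain₂ tau (mu i) (om i) (rho i) (theta i))
        else 0))

open Classical in
/-- The `3 tau`-periodic on/off gain on `[0, ∞)`: `K` on `[(3k+2) tau, (3k+3) tau)` for `k ∈ ℕ`,
and zero on `[3k tau, (3k+2) tau)`. -/
def periodicGain {n : ℕ} (tau : ℝ) (K : Matrix (Fin n) (Fin n) ℝ) (t : ℝ) :
    Matrix (Fin n) (Fin n) ℝ :=
  if ∃ k : ℕ, (3 * (k : ℝ) + 2) * tau ≤ t ∧ t < (3 * (k : ℝ) + 3) * tau then K else 0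

/-! ### The controlled system -/

/-- `x` solves `x'(t) = f (x t) + K(t) (x (t - 2 tau) - x (t - tau))` for `t ∈ S`, where
`S = [t₀, T)` or `S = [t₀, ∞)`, with the initial function `φ` on `[t₀ - 2 tau, t₀]`. The gain is
right-continuous with jumps, so `x` is continuous and the equation holds with the right
derivative. -/
structure IsControlledSolution {n : ℕ} (f : (Fin n → ℝ) → (Fin n → ℝ)) (tau : ℝ)
    (K : Matrix (Fin n) (Fin n) ℝ) (t₀ : ℝ) (φ : ℝ → Fin n → ℝ) (S : Set ℝ)
    (x : ℝ → Fin n → ℝ) : Prop where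
  continuousOn : ContinuousOn x (Icc (t₀ - 2 * tau) t₀ ∪ S)
  initial : EqOn x φ (Icc (t₀ - 2 * tau) t₀)
  equation : ∀ t ∈ S, HasDerivWithinAt x
    (f (x t) + (periodicGain tau K t).mulVec (x (t - 2 * tau) - x (t - tau))) (Ici t) t

/-- `φ` is an initial function on `[t₀ - 2 tau, t₀]` within distance `δ` of `xs`. -/
def IsSmallHistory {n : ℕ} (tau t₀ : ℝ) (xs : Fin n → ℝ) (δ : ℝ) (φ : ℝ → Fin n → ℝ) : Prop :=
  ContinuousOn φ (Icc (t₀ - 2 * tau) t₀) ∧ ∀ s ∈ Icc (t₀ - 2 * tau) t₀, ‖φ s - xs‖ < δ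

/-- Local asymptotic stability of the equilibrium `xs` of the controlled system, as a delay
differential equation. First part: Lyapunov stability, for every solution on any interval
`[t₀, T)`. Second part: every initial function close to `xs` has a solution on `[t₀, ∞)`, and all
such solutions converge to `xs`. (On `Fin n → ℝ` the norm is the maximum norm; the notion does not
depend on the choice of a norm on `ℝⁿ`.) -/
def IsLocallyAsymptoticallyStable {n : ℕ} (f : (Fin n → ℝ) → (Fin n → ℝ)) (tau : ℝ)
    (K : Matrix (Fin n) (Fin n) ℝ) (xs : Fin n → ℝ) : Prop :=
  (∀ ε > 0, ∃ δ > 0, ∀ t₀ ≥ 0, ∀ φ, IsSmallHistory tau t₀ xs δ φ →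
    ∀ T > t₀, ∀ x, IsControlledSolution f tau K t₀ φ (Ico t₀ T) x →
      ∀ t ∈ Ico t₀ T, ‖x t - xs‖ < ε) ∧
  (∃ δ > 0, ∀ t₀ ≥ 0, ∀ φ, IsSmallHistory tau t₀ xs δ φ →
    (∃ x, IsControlledSolution f tau K t₀ φ (Ici t₀) x) ∧
    ∀ x, IsControlledSolution f tau K t₀ φ (Ici t₀) x → Tendsto x atTop (𝓝 xs))

end TDFC

end

/-! ### Lipschitz continuity of piecewise `C¹` fields -/

namespace TDFC

/-! In Jordan coordinates, with each pair of real coordinates read as one complex number, the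
linearised equation is, up to the coupling `N`, a family of scalar modes `u' = L u + k(t) (u(t - 2
tau) - u(t - tau))`. In a period starting at `a = 3 k tau` the control is off for time `2 tau`, and
when it is on both delayed times fall in that free window. So the feedback depends only on `u a`,
and the delay equation has a scalar period map: multiplication by `exp(3 L tau) + tau k (exp(L tau)
- exp(2 L tau))`. This is affine in `k`. The prescribed gains are the solutions of "multiplier =
`zeta`" and "multiplier = `rho exp(i theta)`"; for `Re L < 0` the gain is zero and the multiplier is
`exp(3 L tau)`. In every case its modulus is below one.

Two perturbations remain. Weighting the coordinates of the `i`-th block by `s ^ i` makes the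
coupling as small as desired, and differentiability at the equilibrium makes the nonlinear remainder
small. Both are errors relative to the present state alone, because the gain matrix is exactly
diagonal in these coordinates. Hence they change the period map by a small multiple of the state at
the start of the period (`norm_sub_modeMultiplier_le`, `norm_period_le`), and the contraction
survives (`exists_decay_of_modeMultiplier_lt_one`).

A trapping argument turns this into an a priori bound for the nonlinear equation, which gives
stability and convergence. Existence for all time comes from replacing `f` by a bounded Lipschitz
field that agrees with it near `xs`, solving by steps, and using the a priori bound to see that the
solution never notices the change. Piecewise smoothness serves only to make `f` Lipschitz near `xs`.

The Jordan form itself comes from the structure theorem for torsion modules over `ℝ[X]`: each cyclic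
summand has order a power of a linear or an irreducible quadratic polynomial, and explicit chains of
vectors in it are the Jordan basis. -/

/-- A curve on `[a, b]` that is `L`-Lipschitz on each of finitely many closed sets covering the
interval moves by at most `L (b - a)`. -/
theorem norm_sub_le_of_lipschitzOnWith_closed_cover {F ι : Type*} [NormedAddCommGroup F]
    [Finite ι] {h : ℝ → F} {D : ι → Set ℝ} {a b : ℝ} {L : NNReal} (hab : a ≤ b)
    (hD : ∀ i, IsClosed (D i)) (hcov : Icc a b ⊆ ⋃ i, D i)
    (hL : ∀ i, LipschitzOnWith L h (Icc a b ∩ D i)) : ‖h b - h a‖ ≤ L * (b - a) := by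
  have hcont : ContinuousOn h (Icc a b) := by
    have h1 : ContinuousOn h (⋃ i, Icc a b ∩ D i) :=
      (locallyFinite_of_finite _).continuousOn_iUnion (fun i => isClosed_Icc.inter (hD i))
        fun i => (hL i).continuousOn
    rw [← inter_iUnion] at h1
    exact h1.mono (subset_inter subset_rfl hcov)
  -- Only the liminf of the right slopes needs a bound. Since there are finitely many pieces, one of
  -- them is hit by points arbitrarily close to the right of `x`; being closed it contains `x`, so
  -- its Lipschitz bound applies.
  have key : ∀ x ∈ Ico a b, ∀ r, (L : ℝ) < r →
      ∃ᶠ z in 𝓝[>] x, slope (norm ∘ fun t => h t - h a) x z < r := by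
    intro x hx r hr
    have hev : ∀ᶠ z in 𝓝[>] x, z ∈ Ioc x b := Ioc_mem_nhdsGT hx.2
    have hfr : ∃ᶠ z in 𝓝[>] x, ∃ i, z ∈ D i :=
      (hev.mono fun z hz => mem_iUnion.1 (hcov ⟨hx.1.trans hz.1.le, hz.2⟩)).frequently
    obtain ⟨i, hi⟩ := frequently_exists.1 hfr
    have hxi : x ∈ D i := by
      rw [← (hD i).closure_eq, mem_closure_iff_frequently]
      exact hi.filter_mono nhdsWithin_le_nhds
    refine (hi.and_eventually hev).mono fun z hz => lt_of_le_of_lt ?_ hr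
    have hzx : 0 < z - x := sub_pos.2 hz.2.1
    rw [slope_def_field, div_le_iff₀ hzx]
    have h1 := (hL i).norm_sub_le ⟨⟨hx.1.trans hz.2.1.le, hz.2.2⟩, hz.1⟩ ⟨⟨hx.1, hx.2.le⟩, hxi⟩
    rw [Real.norm_of_nonneg hzx.le] at h1
    refine le_trans ?_ h1
    have h2 := norm_sub_norm_le (h z - h a) (h x - h a)
    simpa using h2
  have h3 := image_le_of_liminf_slope_right_le_deriv_boundary (B := fun t => L * (t - a))
    (B' := fun _ => L) ((hcont.sub continuousOn_const).norm) (by simp) (by fun_prop)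
    (fun x _ => by
      simpa using (((hasDerivAt_id x).sub_const a).const_mul (L : ℝ)).hasDerivWithinAt) key
  exact h3 (right_mem_Icc.2 hab)

/-- A function on a convex set that is `L`-Lipschitz on each of finitely many closed pieces is
`L`-Lipschitz. -/
theorem lipschitzOnWith_of_closed_cover {E F ι : Type*} [NormedAddCommGroup E] [NormedSpace ℝ E]
    [NormedAddCommGroup F] [Finite ι] {f : E → F} {B : Set E} {C : ι → Set E} {L : NNReal}
    (hB : Convex ℝ B) (hC : ∀ i, IsClosed (C i)) (hcov : B ⊆ ⋃ i, C i)
    (hL : ∀ i, LipschitzOnWith L f (B ∩ C i)) : LipschitzOnWith L f B := by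
  refine LipschitzOnWith.of_dist_le_mul fun x hx y hy => ?_
  let l : ℝ → E := AffineMap.lineMap y x
  have hlc : Continuous l := AffineMap.lineMap_continuous
  have hlB : ∀ t ∈ Icc (0 : ℝ) 1, l t ∈ B := fun t ht => hB.lineMap_mem hy hx ht
  have hlL : LipschitzWith (nndist y x) l := lipschitzWith_lineMap y x
  have h := norm_sub_le_of_lipschitzOnWith_closed_cover (h := f ∘ l) (D := fun i => l ⁻¹' C i)
    (L := L * nndist y x) zero_le_one (fun i => (hC i).preimage hlc)
    (fun t ht => by
      obtain ⟨i, hi⟩ := mem_iUnion.1 (hcov (hlB t ht))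
      exact mem_iUnion.2 ⟨i, hi⟩)
    (fun i => (hL i).comp (hlL.lipschitzOnWith) fun t ht => ⟨hlB t ht.1, ht.2⟩)
  simpa [l, dist_eq_norm, dist_comm, norm_sub_rev y x] using h

/-- A piecewise continuously differentiable field is Lipschitz on a closed ball around the point. -/
theorem PiecewiseC1At.exists_lipschitzOnWith {n : ℕ} {f : (Fin n → ℝ) → (Fin n → ℝ)}
    {x : Fin n → ℝ} (hf : PiecewiseC1At f x) :
    ∃ r > 0, ∃ L : NNReal, LipschitzOnWith L f (Metric.closedBall x r) := by
  obtain ⟨U, hU, hxU, k, C, g, hC, hcov, hg⟩ := hf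
  have h1 : ∀ i, ∃ K, ∃ t ∈ 𝓝 x, LipschitzOnWith K (g i) t := fun i =>
    ((hg i).1.contDiffAt (hU.mem_nhds hxU)).exists_lipschitzOnWith
  choose K t ht hK using h1
  have h2 : U ∩ ⋂ i, t i ∈ 𝓝 x := inter_mem (hU.mem_nhds hxU) (iInter_mem.2 ht)
  obtain ⟨r, hr, hrs⟩ := Metric.nhds_basis_closedBall.mem_iff.1 h2
  refine ⟨r, hr, Finset.univ.sup K, lipschitzOnWith_of_closed_cover (convex_closedBall x r) hC
    (fun y hy => hcov (hrs hy).1) fun i => ?_⟩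
  have h3 : LipschitzOnWith (Finset.univ.sup K) (g i) (Metric.closedBall x r ∩ C i) :=
    ((hK i).mono fun y hy => mem_iInter.1 (hrs hy.1).2 i).weaken
      (Finset.le_sup (Finset.mem_univ i))
  intro y hy z hz
  rw [(hg i).2 ⟨(hrs hy.1).1, hy.2⟩, (hg i).2 ⟨(hrs hz.1).1, hz.2⟩]
  exact h3 hy hz

end TDFC

noncomputable section

namespace TDFC

/-! ### A priori estimates -/

/-- Growth estimate for delay equations whose right-hand side at time `t` is at most `c` times a
bound for the solution up to time `t`. -/
theorem norm_le_mul_exp_of_delay_bound {E : Type*} [NormedAddCommGroup E] [NormedSpace ℝ E]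
    {z z' : ℝ → E} {a T c δ : ℝ} (hc : 0 ≤ c) (hz : ContinuousOn z (Icc a T))
    (hd : ∀ t ∈ Ico a T, HasDerivWithinAt z (z' t) (Ici t) t) (ha : ‖z a‖ ≤ δ)
    (hb : ∀ t ∈ Ico a T, ∀ W, δ ≤ W → (∀ s ∈ Icc a t, ‖z s‖ ≤ W) → ‖z' t‖ ≤ c * W) :
    ∀ t ∈ Icc a T, ‖z t‖ ≤ δ * Real.exp (c * (t - a)) := by
  intro t ht
  have hexp : Continuous fun s : ℝ => Real.exp (-(c * (s - a))) := by fun_prop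
  -- Maximise the weighted norm; let `W` be the maximum. If `W > δ`, integrating the bound `c W
  -- exp(c (u - a))` for the derivative up to the maximum point gives `W exp(c (s - a)) ≤ δ + W
  -- (exp(c (s - a)) - 1)`, that is `W ≤ δ`, a contradiction.
  obtain ⟨s, hs, hmax⟩ := isCompact_Icc.exists_isMaxOn ⟨t, ht⟩
    (hz.norm.mul hexp.continuousOn)
  set W : ℝ := ‖z s‖ * Real.exp (-(c * (s - a))) with hW
  have hle : ∀ u ∈ Icc a T, ‖z u‖ ≤ W * Real.exp (c * (u - a)) := by
    intro u hu
    have h1 : ‖z u‖ * Real.exp (-(c * (u - a))) ≤ W := hmax hu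
    rw [Real.exp_neg, ← div_eq_mul_inv, div_le_iff₀ (Real.exp_pos _)] at h1
    exact h1
  by_cases hWδ : W ≤ δ
  · exact (hle t ht).trans (mul_le_mul_of_nonneg_right hWδ (Real.exp_pos _).le)
  push Not at hWδ
  exfalso
  have hW0 : 0 ≤ W := by positivity
  have hB : ∀ u : ℝ, HasDerivAt (fun u => δ + W * (Real.exp (c * (u - a)) - 1))
      (c * (W * Real.exp (c * (u - a)))) u := by
    intro u
    have h1 : HasDerivAt (fun u => c * (u - a)) c u := by
      simpa using ((hasDerivAt_id u).sub_const a).const_mul c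
    exact ((((h1.exp.sub_const 1).const_mul W).const_add δ)).congr_deriv (by ring)
  have h2 := image_norm_le_of_norm_deriv_right_le_deriv_boundary (a := a) (b := s)
    (hz.mono (Icc_subset_Icc_right hs.2)) (fun u hu => hd u ⟨hu.1, hu.2.trans_le hs.2⟩)
    (B := fun u => δ + W * (Real.exp (c * (u - a)) - 1)) (by simpa using ha) hB
    (fun u hu => by
      refine hb u ⟨hu.1, hu.2.trans_le hs.2⟩ _ ?_ ?_
      · have : 1 ≤ Real.exp (c * (u - a)) :=
          Real.one_le_exp (mul_nonneg hc (sub_nonneg.2 hu.1))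
        nlinarith
      · intro v hv
        refine (hle v ⟨hv.1, hv.2.trans (hu.2.le.trans hs.2)⟩).trans ?_
        have : v - a ≤ u - a := by linarith [hv.2]
        gcongr)
    (right_mem_Icc.2 hs.1)
  have h3 : ‖z s‖ = W * Real.exp (c * (s - a)) := by
    rw [hW, mul_assoc, ← Real.exp_add]; simp
  rw [h3] at h2
  linarith

/-! ### Period map of a scalar mode -/

/-- Sensitivity of the period map of a scalar mode to perturbations of the equation. -/
def modeSensitivity (tau : ℝ) (L k : ℂ) : ℝ :=
  Real.exp (3 * ‖L‖ * tau) * (2 * tau * Real.exp (3 * ‖L‖ * tau) +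
    tau * (4 * ‖k‖ * tau * Real.exp (3 * ‖L‖ * tau) ^ 2 + Real.exp (3 * ‖L‖ * tau)))

/-- The multiplier over one period of the scalar mode `L` under the gain `k`. -/
def modeMultiplier (tau : ℝ) (L k : ℂ) : ℂ :=
  Complex.exp (3 * L * tau) + tau * k * (Complex.exp (L * tau) - Complex.exp (2 * L * tau))

theorem modeSensitivity_nonneg {tau : ℝ} (htau : 0 ≤ tau) (L k : ℂ) :
    0 ≤ modeSensitivity tau L k := by
  unfold modeSensitivity; positivity

/-- Over one period, a perturbed scalar mode is multiplied by `modeMultiplier`, up to an error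
proportional to the perturbation. -/
theorem norm_sub_modeMultiplier_le {u e : ℝ → ℂ} {L k : ℂ} {tau a ε : ℝ} (htau : 0 < tau)
    (hu : ContinuousOn u (Icc a (a + 3 * tau)))
    (hfree : ∀ t ∈ Ico a (a + 2 * tau), HasDerivWithinAt u (L * u t + e t) (Ici t) t)
    (hctrl : ∀ t ∈ Ico (a + 2 * tau) (a + 3 * tau), HasDerivWithinAt u
      (L * u t + e t + k * (u (t - 2 * tau) - u (t - tau))) (Ici t) t)
    (he : ∀ t ∈ Ico a (a + 3 * tau), ‖e t‖ ≤ ε) :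
    ‖u (a + 3 * tau) - modeMultiplier tau L k * u a‖ ≤ modeSensitivity tau L k * ε := by
  set P : ℝ := Real.exp (3 * ‖L‖ * tau) with hP
  have hε : 0 ≤ ε := (norm_nonneg _).trans (he a ⟨le_rfl, by linarith⟩)
  have hP0 : 0 ≤ P := (Real.exp_pos _).le
  have hexpP : ∀ s : ℝ, |s| ≤ 3 * tau → ‖Complex.exp (L * s)‖ ≤ P := by
    intro s hs
    rw [Complex.norm_exp]
    refine Real.exp_le_exp.2 ((Complex.re_le_norm _).trans ?_)
    rw [norm_mul, Complex.norm_real, Real.norm_eq_abs]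
    nlinarith [norm_nonneg L]
  -- Integrating factor: `w = E u` would be constant in unperturbed free motion, so on the free
  -- window it moves only by the accumulated error.
  let E : ℝ → ℂ := fun t => Complex.exp (L * ((-(t - a) : ℝ) : ℂ))
  have hEd : ∀ t, HasDerivAt E (-L * E t) t := by
    intro t
    have h1 : HasDerivAt (fun t : ℝ => ((-(t - a) : ℝ) : ℂ)) (-1 : ℂ) t := by
      have := (((hasDerivAt_id t).sub_const a).neg).ofReal_comp
      simpa using this
    have h2 := (h1.const_mul L).cexp
    exact h2.congr_deriv (by simp only [E]; ring)
  have hEc : Continuous E := by fun_prop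
  have hEP : ∀ t ∈ Icc a (a + 3 * tau), ‖E t‖ ≤ P := by
    intro t ht
    refine hexpP _ ?_
    rw [abs_neg, abs_of_nonneg (by linarith [ht.1])]
    linarith [ht.2]
  have hEa : E a = 1 := by simp [E]
  set w : ℝ → ℂ := fun t => E t * u t with hw
  have hwa : w a = u a := by simp [hw, hEa]
  have hwc : ContinuousOn w (Icc a (a + 3 * tau)) := hEc.continuousOn.mul hu
  have hstep1 : ∀ t ∈ Icc a (a + 2 * tau), ‖w t - w a‖ ≤ P * ε * (2 * tau) := by
    intro t ht
    have h := norm_image_sub_le_of_norm_deriv_right_le_segment (f' := fun t => E t * e t)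
      (hwc.mono (Icc_subset_Icc_right (by linarith))) (b := a + 2 * tau)
      (fun t ht => (((hEd t).hasDerivWithinAt).mul (hfree t ht)).congr_deriv (by ring))
      (C := P * ε)
      (fun t ht => by
        rw [norm_mul]
        have h1 : t ∈ Ico a (a + 3 * tau) := ⟨ht.1, by linarith [ht.2]⟩
        exact mul_le_mul (hEP t (Ico_subset_Icc_self h1)) (he t h1) (norm_nonneg _) hP0) t ht
    refine h.trans ?_
    have : 0 ≤ P * ε := by positivity
    nlinarith [ht.2]
  -- The derivative that `w` would have in the control window if it had kept the value `w a` on the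
  -- free window. It is constant in time because `E t * u (t - d) = exp(-L d) w (t - d)`, so after
  -- subtracting the linear growth `(t - (a + 2 tau)) c` only errors remain.
  set c : ℂ := k * (Complex.exp (L * ((-(2 * tau) : ℝ) : ℂ)) - Complex.exp (L * ((-tau : ℝ) : ℂ)))
    * w a with hc
  have hstep2 := norm_image_sub_le_of_norm_deriv_right_le_segment
      (f := fun t => w t - (t - (a + 2 * tau) : ℝ) * c)
      (f' := fun t => E t * e t + k * (Complex.exp (L * ((-(2 * tau) : ℝ) : ℂ)) *
        (w (t - 2 * tau) - w a) - Complex.exp (L * ((-tau : ℝ) : ℂ)) * (w (t - tau) - w a)))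
      (a := a + 2 * tau) (b := a + 3 * tau) (C := P * ε + ‖k‖ * (2 * P * (P * ε * (2 * tau))))
      ((hwc.mono (Icc_subset_Icc_left (by linarith))).sub (by fun_prop))
      (fun t ht => by
        have h1 : HasDerivAt (fun t : ℝ => ((t - (a + 2 * tau) : ℝ) : ℂ) * c) (1 * c) t := by
          have := ((hasDerivAt_id t).sub_const (a + 2 * tau)).ofReal_comp.mul_const c
          simpa using this
        refine ((((hEd t).hasDerivWithinAt).mul (hctrl t ht)).sub
          h1.hasDerivWithinAt).congr_deriv ?_
        have e1 : E t * u (t - 2 * tau) =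
            Complex.exp (L * ((-(2 * tau) : ℝ) : ℂ)) * w (t - 2 * tau) := by
          simp only [hw, E, ← mul_assoc, ← Complex.exp_add]
          congr 2
          push_cast; ring
        have e2 : E t * u (t - tau) =
            Complex.exp (L * ((-tau : ℝ) : ℂ)) * w (t - tau) := by
          simp only [hw, E, ← mul_assoc, ← Complex.exp_add]
          congr 2
          push_cast; ring
        rw [hc]
        linear_combination k * e1 - k * e2)
      (fun t ht => by
        have h1 : t ∈ Ico a (a + 3 * tau) := ⟨by linarith [ht.1], ht.2⟩
        refine (norm_add_le _ _).trans (add_le_add ?_ ?_)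
        · rw [norm_mul]
          exact mul_le_mul (hEP t (Ico_subset_Icc_self h1)) (he t h1) (norm_nonneg _) hP0
        · rw [norm_mul]
          refine mul_le_mul_of_nonneg_left ((norm_sub_le _ _).trans ?_) (norm_nonneg _)
          rw [norm_mul, norm_mul]
          have h2 := hstep1 (t - 2 * tau) ⟨by linarith [ht.1], by linarith [ht.2]⟩
          have h3 := hstep1 (t - tau) ⟨by linarith [ht.1], by linarith [ht.2]⟩
          have h4 := hexpP (-(2 * tau)) (by rw [abs_neg, abs_of_pos (by linarith)]; linarith)
          have h5 := hexpP (-tau) (by rw [abs_neg, abs_of_pos (by linarith)]; linarith)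
          have h6 := mul_le_mul h4 h2 (norm_nonneg _) hP0
          have h7 := mul_le_mul h5 h3 (norm_nonneg _) hP0
          linarith)
      (a + 3 * tau) (right_mem_Icc.2 (by linarith))
  have h1 := hstep1 (a + 2 * tau) (right_mem_Icc.2 (by linarith))
  have h2 : ‖w (a + 3 * tau) - tau * c - w a‖ ≤
      P * ε * (2 * tau) + (P * ε + ‖k‖ * (2 * P * (P * ε * (2 * tau)))) * tau := by
    have h3 : w (a + 3 * tau) - tau * c - w a = (w (a + 2 * tau) - w a) +
        ((w (a + 3 * tau) - (a + 3 * tau - (a + 2 * tau) : ℝ) * c) -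
          (w (a + 2 * tau) - (a + 2 * tau - (a + 2 * tau) : ℝ) * c)) := by
      push_cast; ring
    rw [h3]
    refine (norm_add_le _ _).trans (add_le_add h1 (hstep2.trans_eq ?_))
    ring
  have h3 : u (a + 3 * tau) - modeMultiplier tau L k * u a =
      Complex.exp (L * ((3 * tau : ℝ) : ℂ)) * (w (a + 3 * tau) - tau * c - w a) := by
    have e1 : Complex.exp (L * ((3 * tau : ℝ) : ℂ)) * w (a + 3 * tau) = u (a + 3 * tau) := by
      simp only [hw, E, ← mul_assoc, ← Complex.exp_add]
      have : L * ((3 * tau : ℝ) : ℂ) + L * ((-(a + 3 * tau - a) : ℝ) : ℂ) = 0 := by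
        push_cast; ring
      rw [this]; simp
    have e2 : Complex.exp (L * ((3 * tau : ℝ) : ℂ)) * Complex.exp (L * ((-(2 * tau) : ℝ) : ℂ)) =
        Complex.exp (L * tau) := by
      rw [← Complex.exp_add]; congr 1; push_cast; ring
    have e3 : Complex.exp (L * ((3 * tau : ℝ) : ℂ)) * Complex.exp (L * ((-tau : ℝ) : ℂ)) =
        Complex.exp (2 * L * tau) := by
      rw [← Complex.exp_add]; congr 1; push_cast; ring
    have e4 : Complex.exp (3 * L * tau) = Complex.exp (L * ((3 * tau : ℝ) : ℂ)) := by
      congr 1; push_cast; ring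
    rw [modeMultiplier, hc, e4, ← e1, hwa, ← e2, ← e3]
    ring
  rw [h3, norm_mul]
  have h4 := mul_le_mul (hexpP (3 * tau) (by rw [abs_of_pos (by linarith)])) h2
    (norm_nonneg _) hP0
  refine h4.trans_eq ?_
  rw [modeSensitivity, ← hP]
  ring

/-! ### On/off switching of the gain -/

open Classical in
/-- The switching function of the gain: `1` where the control is on, `0` where it is off. -/
def gainSwitch (tau t : ℝ) : ℝ :=
  if ∃ k : ℕ, (3 * (k : ℝ) + 2) * tau ≤ t ∧ t < (3 * (k : ℝ) + 3) * tau then 1 else 0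

theorem periodicGain_eq_smul {n : ℕ} (tau : ℝ) (K : Matrix (Fin n) (Fin n) ℝ) (t : ℝ) :
    periodicGain tau K t = gainSwitch tau t • K := by
  unfold periodicGain gainSwitch
  split_ifs <;> simp

theorem abs_gainSwitch_le_one (tau t : ℝ) : |gainSwitch tau t| ≤ 1 := by
  unfold gainSwitch; split_ifs <;> simp

theorem gainSwitch_eq_one {tau t : ℝ} {k : ℕ} (h₁ : (3 * (k : ℝ) + 2) * tau ≤ t)
    (h₂ : t < (3 * (k : ℝ) + 3) * tau) : gainSwitch tau t = 1 :=
  if_pos ⟨k, h₁, h₂⟩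

theorem gainSwitch_eq_zero {tau t : ℝ} {k : ℕ} (htau : 0 < tau) (h₁ : 3 * (k : ℝ) * tau ≤ t)
    (h₂ : t < (3 * (k : ℝ) + 2) * tau) : gainSwitch tau t = 0 := by
  refine if_neg ?_
  rintro ⟨j, hj₁, hj₂⟩
  have h3 : (3 * (j : ℝ) + 2) < 3 * k + 2 := lt_of_mul_lt_mul_right (hj₁.trans_lt h₂) htau.le
  have h4 : (3 * (k : ℝ)) < 3 * j + 3 := lt_of_mul_lt_mul_right (h₁.trans_lt hj₂) htau.le
  norm_cast at h3 h4
  omega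

/-! ### Approximately diagonal systems: growth and contraction -/

variable {ι : Type*} [Fintype ι]

/-- `z` satisfies the controlled delay equation for decoupled complex modes `L` with gains `κ` on
`[t₀, T)`, up to a relative error `η`, from a history bounded by `δ`. -/
structure IsApproxModeSolution (tau : ℝ) (L κ : ι → ℂ) (η t₀ T δ : ℝ) (g z : ℝ → ι → ℂ) :
    Prop where
  continuousOn : ContinuousOn z (Icc (t₀ - 2 * tau) T)
  history : ∀ s ∈ Icc (t₀ - 2 * tau) t₀, ‖z s‖ ≤ δ
  equation : ∀ t ∈ Ico t₀ T, HasDerivWithinAt z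
    (g t + gainSwitch tau t • (κ * (z (t - 2 * tau) - z (t - tau)))) (Ici t) t
  error : ∀ t ∈ Ico t₀ T, ‖g t - L * z t‖ ≤ η * ‖z t‖

/-- Exponential growth rate available for all approximate mode solutions. -/
def modeRate (L κ : ι → ℂ) : ℝ := ‖L‖ + 1 + 2 * ‖κ‖

theorem modeRate_nonneg (L κ : ι → ℂ) : 0 ≤ modeRate L κ := by unfold modeRate; positivity

namespace IsApproxModeSolution

variable {tau η t₀ T δ : ℝ} {L κ : ι → ℂ} {g z : ℝ → ι → ℂ}

/-- Feeds both growth estimates below. The alternative in the last hypothesis lets the estimate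
within a period ignore the history before its start: delayed values need a bound only while the
switch is on. -/
theorem norm_rhs_le (h : IsApproxModeSolution tau L κ η t₀ T δ g z) (hη : η ≤ 1) {t W : ℝ}
    (ht : t ∈ Ico t₀ T) (hW : 0 ≤ W) (h0 : ‖z t‖ ≤ W)
    (h1 : gainSwitch tau t = 0 ∨ (‖z (t - 2 * tau)‖ ≤ W ∧ ‖z (t - tau)‖ ≤ W)) :
    ‖g t + gainSwitch tau t • (κ * (z (t - 2 * tau) - z (t - tau)))‖ ≤ modeRate L κ * W := by
  have hg : ‖g t‖ ≤ (‖L‖ + 1) * W := by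
    have e1 : g t = (g t - L * z t) + L * z t := by ring
    rw [e1]
    refine (norm_add_le _ _).trans ?_
    have h2 := h.error t ht
    have h3 := norm_mul_le L (z t)
    have h4 : η * ‖z t‖ ≤ 1 * W := mul_le_mul hη h0 (norm_nonneg _) zero_le_one
    have h5 : ‖L‖ * ‖z t‖ ≤ ‖L‖ * W := by gcongr
    linarith
  have hd : ‖gainSwitch tau t • (κ * (z (t - 2 * tau) - z (t - tau)))‖ ≤ 2 * ‖κ‖ * W := by
    rcases h1 with h1 | ⟨h1, h2⟩
    · rw [h1, zero_smul, norm_zero]; positivity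
    · rw [norm_smul, Real.norm_eq_abs]
      have h3 : ‖κ * (z (t - 2 * tau) - z (t - tau))‖ ≤ 2 * ‖κ‖ * W := by
        refine (norm_mul_le _ _).trans ?_
        have h4 := norm_sub_le (z (t - 2 * tau)) (z (t - tau))
        nlinarith [norm_nonneg κ]
      have := mul_le_mul (abs_gainSwitch_le_one tau t) h3 (norm_nonneg _) zero_le_one
      linarith
  refine (norm_add_le _ _).trans ?_
  unfold modeRate
  linarith

/-- Growth from the initial time. -/
theorem norm_le_of_history (h : IsApproxModeSolution tau L κ η t₀ T δ g z) (htau : 0 < tau)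
    (hη : η ≤ 1) : ∀ t ∈ Icc t₀ T, ‖z t‖ ≤ δ * Real.exp (modeRate L κ * (t - t₀)) := by
  have hδ : ‖z t₀‖ ≤ δ := h.history t₀ (right_mem_Icc.2 (by linarith))
  have hδ0 : 0 ≤ δ := (norm_nonneg _).trans hδ
  refine norm_le_mul_exp_of_delay_bound (modeRate_nonneg L κ)
    (h.continuousOn.mono (Icc_subset_Icc_left (by linarith))) h.equation hδ ?_
  intro t ht W hW hs
  have hpast : ∀ s, t₀ - 2 * tau ≤ s → s ≤ t → ‖z s‖ ≤ W := by
    intro s h1 h2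
    rcases le_total s t₀ with h3 | h3
    · exact (h.history s ⟨h1, h3⟩).trans hW
    · exact hs s ⟨h3, h2⟩
  exact h.norm_rhs_le hη ht (hδ0.trans hW) (hs t ⟨ht.1, le_rfl⟩)
    (Or.inr ⟨hpast _ (by linarith [ht.1]) (by linarith), hpast _ (by linarith [ht.1])
      (by linarith)⟩)

/-- Growth within a control period, from the state at its start. -/
theorem norm_le_of_period (h : IsApproxModeSolution tau L κ η t₀ T δ g z) (htau : 0 < tau)
    (hη : η ≤ 1) {k : ℕ} (hk : t₀ ≤ 3 * k * tau) :
    ∀ t ∈ Icc (3 * k * tau) T, t ≤ 3 * k * tau + 3 * tau →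
      ‖z t‖ ≤ ‖z (3 * k * tau)‖ * Real.exp (modeRate L κ * (3 * tau)) := by
  intro t ht ht3
  have h1 := norm_le_mul_exp_of_delay_bound (a := 3 * k * tau) (T := t) (modeRate_nonneg L κ)
    (h.continuousOn.mono (Icc_subset_Icc (by linarith) ht.2))
    (fun s hs => h.equation s ⟨hk.trans hs.1, hs.2.trans_le ht.2⟩) le_rfl
    (fun s hs W hW hb => by
      refine h.norm_rhs_le hη ⟨hk.trans hs.1, hs.2.trans_le ht.2⟩ ((norm_nonneg _).trans hW)
        (hb s ⟨hs.1, le_rfl⟩) ?_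
      -- Either the control is off, or `s` is at least `2 tau` into the period and both delayed
      -- times lie in the same period.
      rcases lt_or_ge s ((3 * (k : ℝ) + 2) * tau) with h2 | h2
      · exact Or.inl (gainSwitch_eq_zero htau hs.1 h2)
      · exact Or.inr ⟨hb _ ⟨by linarith, by linarith⟩, hb _ ⟨by linarith, by linarith⟩⟩)
    t (right_mem_Icc.2 ht.1)
  refine h1.trans ?_
  have h2 : t - 3 * k * tau ≤ 3 * tau := by linarith
  have := modeRate_nonneg L κ
  gcongr

/-- Contraction over a control period. -/
theorem norm_period_le (h : IsApproxModeSolution tau L κ η t₀ T δ g z) (htau : 0 < tau)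
    (hη0 : 0 ≤ η) (hη : η ≤ 1) {k : ℕ} (hk : t₀ ≤ 3 * k * tau) (hT : 3 * k * tau + 3 * tau ≤ T) :
    ‖z (3 * k * tau + 3 * tau)‖ ≤ (‖fun i => modeMultiplier tau (L i) (κ i)‖ +
      (∑ i, modeSensitivity tau (L i) (κ i)) * (η * Real.exp (modeRate L κ * (3 * tau)))) *
        ‖z (3 * k * tau)‖ := by
  set a : ℝ := 3 * k * tau with ha
  set G : ℝ := Real.exp (modeRate L κ * (3 * tau)) with hG
  have hS : ∀ i, 0 ≤ modeSensitivity tau (L i) (κ i) := fun i =>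
    modeSensitivity_nonneg htau.le _ _
  have hS' : 0 ≤ ∑ i, modeSensitivity tau (L i) (κ i) := Finset.sum_nonneg fun i _ => hS i
  refine (pi_norm_le_iff_of_nonneg (by positivity)).2 fun i => ?_
  have hsub : ∀ t ∈ Ico a (a + 3 * tau), t ∈ Ico t₀ T := fun t ht =>
    ⟨hk.trans ht.1, ht.2.trans_le hT⟩
  have hderiv : ∀ t ∈ Ico a (a + 3 * tau), HasDerivWithinAt (fun s => z s i)
      (g t i + gainSwitch tau t • (κ i * (z (t - 2 * tau) i - z (t - tau) i))) (Ici t) t :=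
    fun t ht => (hasDerivWithinAt_pi.1 (h.equation t (hsub t ht))) i
  -- The relative error becomes an absolute one, `η ‖z a‖ G`, since within the period the state is
  -- at most `G` times its value at the start.
  have key := norm_sub_modeMultiplier_le (u := fun s => z s i) (e := fun t => g t i - L i * z t i)
    (L := L i) (k := κ i) (a := a) (ε := η * (‖z a‖ * G)) htau
    ((continuousOn_pi.1 (h.continuousOn.mono (Icc_subset_Icc (by linarith) hT))) i)
    (fun t ht => by
      have := hderiv t ⟨ht.1, by linarith [ht.2]⟩
      rw [gainSwitch_eq_zero (k := k) htau ht.1 (by linarith [ht.2])] at this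
      exact this.congr_deriv (by simp))
    (fun t ht => by
      have := hderiv t ⟨by linarith [ht.1], ht.2⟩
      rw [gainSwitch_eq_one (k := k) (by linarith [ht.1]) (by linarith [ht.2])] at this
      exact this.congr_deriv (by simp))
    (fun t ht => by
      refine (norm_le_pi_norm (g t - L * z t) i).trans ((h.error t (hsub t ht)).trans ?_)
      gcongr
      exact h.norm_le_of_period htau hη hk t ⟨ht.1, (hsub t ht).2.le⟩ ht.2.le)
  have h1 : ‖modeMultiplier tau (L i) (κ i) * z a i‖ ≤
      ‖fun i => modeMultiplier tau (L i) (κ i)‖ * ‖z a‖ := by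
    rw [norm_mul]
    exact mul_le_mul (norm_le_pi_norm (fun i => modeMultiplier tau (L i) (κ i)) i)
      (norm_le_pi_norm (z a) i) (norm_nonneg _) (norm_nonneg _)
  have h2 : modeSensitivity tau (L i) (κ i) * (η * (‖z a‖ * G)) ≤
      (∑ i, modeSensitivity tau (L i) (κ i)) * (η * (‖z a‖ * G)) := by
    refine mul_le_mul_of_nonneg_right ?_ (by positivity)
    exact Finset.single_le_sum (f := fun i => modeSensitivity tau (L i) (κ i))
      (fun i _ => hS i) (Finset.mem_univ i)
  have h3 := norm_le_insert' (z (a + 3 * tau) i) (modeMultiplier tau (L i) (κ i) * z a i)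
  linarith

end IsApproxModeSolution

/-- Decay of all approximate mode solutions, if the multipliers are smaller than one and the
relative error is small. -/
theorem exists_decay_of_modeMultiplier_lt_one {tau : ℝ} (htau : 0 < tau) {L κ : ι → ℂ}
    (hmult : ∀ i, ‖modeMultiplier tau (L i) (κ i)‖ < 1) :
    ∃ η > 0, ∃ q, 0 ≤ q ∧ q < 1 ∧ ∃ G > 0, ∀ (t₀ T δ : ℝ) (g z : ℝ → ι → ℂ), 0 ≤ t₀ →
      IsApproxModeSolution tau L κ η t₀ T δ g z → ∀ t ∈ Icc t₀ T,
        ‖z t‖ ≤ G * δ ∧ ∀ k : ℕ, t₀ + 3 * (k + 1) * tau ≤ t → ‖z t‖ ≤ G * q ^ k * δ := by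
  set q₀ : ℝ := ‖fun i => modeMultiplier tau (L i) (κ i)‖ with hq₀
  have hq₀1 : q₀ < 1 := (pi_norm_lt_iff zero_lt_one).2 hmult
  have hq₀0 : 0 ≤ q₀ := norm_nonneg _
  set S : ℝ := ∑ i, modeSensitivity tau (L i) (κ i) with hS
  have hS0 : 0 ≤ S := Finset.sum_nonneg fun i _ => modeSensitivity_nonneg htau.le _ _
  set G : ℝ := Real.exp (modeRate L κ * (3 * tau)) with hG
  have hG1 : 1 ≤ G := Real.one_le_exp (mul_nonneg (modeRate_nonneg L κ) (by linarith))
  have hden : 0 < S * G + 1 := by positivity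
  -- Chosen so that `q₀ + S η G` is at most the midpoint `q` of `q₀` and `1`. The cap `1` is what
  -- `modeRate` allows for.
  set η : ℝ := min 1 ((1 - q₀) / 2 / (S * G + 1)) with hη
  have hη0 : 0 < η := lt_min one_pos (div_pos (by linarith) hden)
  have hη1 : η ≤ 1 := min_le_left _ _
  set q : ℝ := (1 + q₀) / 2 with hq
  have hqle : q₀ + S * (η * G) ≤ q := by
    have h1 : η * (S * G + 1) ≤ (1 - q₀) / 2 := (le_div_iff₀ hden).1 (min_le_right _ _)
    rw [hq]; linarith
  have hq0 : 0 ≤ q := by rw [hq]; linarith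
  have hq1 : q < 1 := by rw [hq]; linarith
  -- One factor `G` pays for the time from `t₀` to the first period start, the other for growth
  -- inside the current period.
  refine ⟨η, hη0, q, hq0, hq1, G * G, by positivity, ?_⟩
  intro t₀ T δ g z ht₀ h t ht
  have hδ0 : 0 ≤ δ := (norm_nonneg _).trans (h.history t₀ (right_mem_Icc.2 (by linarith)))
  have hearly : ∀ s ∈ Icc t₀ T, s ≤ t₀ + 3 * tau → ‖z s‖ ≤ G * δ := by
    intro s hs hs3
    refine (h.norm_le_of_history htau hη1 s hs).trans ?_
    rw [mul_comm]
    refine mul_le_mul_of_nonneg_right (Real.exp_le_exp.2 ?_) hδ0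
    exact mul_le_mul_of_nonneg_left (by linarith) (modeRate_nonneg L κ)
  have h3tau : 0 < 3 * tau := by linarith
  set k₀ : ℕ := ⌈t₀ / (3 * tau)⌉₊ with hk₀
  have hk₀1 : t₀ ≤ 3 * k₀ * tau := by
    have := (div_le_iff₀ h3tau).1 (Nat.le_ceil (t₀ / (3 * tau)))
    rw [← hk₀] at this; linarith
  have hk₀2 : 3 * k₀ * tau < t₀ + 3 * tau := by
    have h1 := Nat.ceil_lt_add_one (div_nonneg ht₀ h3tau.le)
    rw [← hk₀] at h1
    have h2 : t₀ / (3 * tau) * (3 * tau) = t₀ := div_mul_cancel₀ _ h3tau.ne'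
    nlinarith
  have hmon : ∀ j : ℕ, 3 * (k₀ : ℝ) * tau ≤ 3 * ((k₀ + j : ℕ) : ℝ) * tau := by
    intro j; push_cast
    have : 0 ≤ (j : ℝ) * tau := by positivity
    linarith
  have hper : ∀ j : ℕ, 3 * ((k₀ + j : ℕ) : ℝ) * tau ≤ T →
      ‖z (3 * ((k₀ + j : ℕ) : ℝ) * tau)‖ ≤ q ^ j * (G * δ) := by
    intro j
    induction j with
    | zero =>
      intro hT
      simpa using hearly (3 * k₀ * tau) ⟨hk₀1, by simpa using hT⟩ hk₀2.le
    | succ j ih =>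
      intro hT
      have e1 : 3 * ((k₀ + (j + 1) : ℕ) : ℝ) * tau = 3 * ((k₀ + j : ℕ) : ℝ) * tau + 3 * tau := by
        push_cast; ring
      rw [e1] at hT ⊢
      have h1 := h.norm_period_le htau hη0.le hη1 (hk₀1.trans (hmon j)) hT
      have h2 := ih (by linarith)
      calc _ ≤ q * ‖z (3 * ((k₀ + j : ℕ) : ℝ) * tau)‖ :=
            h1.trans (mul_le_mul_of_nonneg_right hqle (norm_nonneg _))
        _ ≤ q * (q ^ j * (G * δ)) := by gcongr
        _ = q ^ (j + 1) * (G * δ) := by ring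
  have hlate : 3 * k₀ * tau ≤ t → ∃ j : ℕ, t < 3 * ((k₀ + j : ℕ) : ℝ) * tau + 3 * tau ∧
      ‖z t‖ ≤ G * G * q ^ j * δ := by
    intro hkt
    have ht0 : 0 ≤ t := ht₀.trans ht.1
    have hfl1 : k₀ ≤ ⌊t / (3 * tau)⌋₊ := by
      refine Nat.le_floor ((le_div_iff₀ h3tau).2 (by linarith))
    obtain ⟨j, hj⟩ := Nat.exists_eq_add_of_le hfl1
    have hj1 : 3 * ((k₀ + j : ℕ) : ℝ) * tau ≤ t := by
      have := (le_div_iff₀ h3tau).1 (Nat.floor_le (div_nonneg ht0 h3tau.le))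
      rw [hj] at this; linarith
    have hj2 : t < 3 * ((k₀ + j : ℕ) : ℝ) * tau + 3 * tau := by
      have := (div_lt_iff₀ h3tau).1 (Nat.lt_floor_add_one (t / (3 * tau)))
      rw [hj] at this; linarith
    refine ⟨j, hj2, ?_⟩
    have h1 := h.norm_le_of_period htau hη1 (hk₀1.trans (hmon j)) t ⟨hj1, ht.2⟩ hj2.le
    have h2 := hper j (hj1.trans ht.2)
    rw [← hG] at h1
    calc ‖z t‖ ≤ q ^ j * (G * δ) * G := h1.trans (by gcongr)
      _ = G * G * q ^ j * δ := by ring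
  constructor
  · rcases le_total t (3 * k₀ * tau) with h1 | h1
    · refine (hearly t ht (by linarith)).trans ?_
      have : G * δ ≤ G * (G * δ) := le_mul_of_one_le_left (by positivity) hG1
      linarith
    · obtain ⟨j, -, hj⟩ := hlate h1
      refine hj.trans ?_
      have : q ^ j ≤ 1 := pow_le_one₀ hq0 hq1.le
      have h2 : G * G * q ^ j ≤ G * G * 1 := by gcongr
      rw [mul_one] at h2
      exact mul_le_mul_of_nonneg_right h2 hδ0
  · intro k hkt
    have hk0 : 0 ≤ (k : ℝ) * tau := by positivity
    obtain ⟨j, hj1, hj2⟩ := hlate (by linarith)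
    -- The first period start comes less than `3 tau` after `t₀`; this lost period is the reason for
    -- `k + 1` in the statement.
    have hkj : k ≤ j := by
      by_contra! hlt
      have h1 : ((j : ℝ) + 1) ≤ k := by exact_mod_cast hlt
      have h2 : ((j : ℝ) + 1) * tau ≤ k * tau := by gcongr
      push_cast at hj1
      linarith
    refine hj2.trans ?_
    have := pow_le_pow_of_le_one hq0 hq1.le hkj
    gcongr

end TDFC

end

noncomputable section

namespace TDFC

/-! ### Global existence for bounded Lipschitz fields -/

/-- The forced equation `α' = F α + g t` with bounded Lipschitz `F` has a solution on all of
`[a, b]`. -/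
theorem exists_solution_of_bounded_lipschitz {E : Type*} [NormedAddCommGroup E] [NormedSpace ℝ E]
    [CompleteSpace E] {F : E → E} {L : NNReal} {M : ℝ} (hF : LipschitzWith L F)
    (hM : ∀ x, ‖F x‖ ≤ M) {g : ℝ → E} {a b : ℝ} (hab : a ≤ b) (hg : ContinuousOn g (Icc a b))
    (x₀ : E) : ∃ α : ℝ → E, α a = x₀ ∧
      ∀ t ∈ Icc a b, HasDerivWithinAt α (F (α t) + g t) (Icc a b) t := by
  obtain ⟨C, hC⟩ := isCompact_Icc.exists_bound_of_continuousOn hg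
  have hM0 : 0 ≤ M := (norm_nonneg _).trans (hM x₀)
  have hC0 : 0 ≤ C := (norm_nonneg _).trans (hC a ⟨le_rfl, hab⟩)
  -- Boundedness of the right-hand side keeps solutions in the ball of radius `(M + C) (b - a)`, so
  -- no smallness of the interval is needed.
  have hPL : IsPicardLindelof (fun t x => F x + g t) (⟨a, le_rfl, hab⟩ : Icc a b) x₀
      (Real.toNNReal ((M + C) * (b - a))) 0 (Real.toNNReal (M + C)) L := by
    refine ⟨fun t _ => ?_, fun x _ => continuousOn_const.add hg, fun t ht x _ => ?_, ?_⟩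
    · refine LipschitzWith.lipschitzOnWith ?_
      simpa using hF.add (LipschitzWith.const (g t))
    · rw [Real.coe_toNNReal _ (by positivity)]
      exact (norm_add_le _ _).trans (add_le_add (hM x) (hC t ht))
    · have hba : 0 ≤ b - a := sub_nonneg.2 hab
      rw [Real.coe_toNNReal _ (by positivity), Real.coe_toNNReal _ (by positivity)]
      simp [hba]
  exact hPL.exists_eq_forall_mem_Icc_hasDerivWithinAt₀

/-- A continuous solution on the closed interval `[t₀ - 2 tau, a]`. -/
structure IsSolutionUpTo {n : ℕ} (F : (Fin n → ℝ) → (Fin n → ℝ)) (tau : ℝ)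
    (K : Matrix (Fin n) (Fin n) ℝ) (t₀ : ℝ) (φ : ℝ → Fin n → ℝ) (a : ℝ) (u : ℝ → Fin n → ℝ) :
    Prop where
  continuousOn : ContinuousOn u (Icc (t₀ - 2 * tau) a)
  initial : ∀ t ≤ t₀, u t = φ t
  equation : ∀ t ∈ Ico t₀ a, HasDerivWithinAt u
    (F (u t) + (periodicGain tau K t).mulVec (u (t - 2 * tau) - u (t - tau))) (Ici t) t

variable {n : ℕ} {F : (Fin n → ℝ) → (Fin n → ℝ)} {tau t₀ : ℝ} {K : Matrix (Fin n) (Fin n) ℝ}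
  {φ : ℝ → Fin n → ℝ}

/-- Method of steps: a solution extends over an interval of length at most `tau` on which the gain
is constant. -/
theorem IsSolutionUpTo.exists_extension {L : NNReal} {M : ℝ} (hF : LipschitzWith L F)
    (hM : ∀ x, ‖F x‖ ≤ M) (htau : 0 < tau) {a b : ℝ} {u : ℝ → Fin n → ℝ}
    (hu : IsSolutionUpTo F tau K t₀ φ a u) (hta : t₀ ≤ a) (hab : a ≤ b) (hba : b ≤ a + tau)
    {Ka : Matrix (Fin n) (Fin n) ℝ} (hK : ∀ t ∈ Ico a b, periodicGain tau K t = Ka) :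
    ∃ v, IsSolutionUpTo F tau K t₀ φ b v ∧ ∀ t ≤ a, v t = u t := by
  -- As `b ≤ a + tau`, both delayed times are at most `a`: the delayed term is a known continuous
  -- forcing, and what remains is an ordinary differential equation.
  have hg : ContinuousOn (fun t => Ka.mulVec (u (t - 2 * tau) - u (t - tau))) (Icc a b) := by
    have hlin : Continuous fun v : Fin n → ℝ => Ka.mulVec v :=
      (Matrix.mulVecLin Ka).continuous_of_finiteDimensional
    refine hlin.comp_continuousOn (ContinuousOn.sub ?_ ?_)
    · exact hu.continuousOn.comp (by fun_prop) fun t ht =>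
        ⟨by linarith [ht.1], by linarith [ht.2]⟩
    · exact hu.continuousOn.comp (by fun_prop) fun t ht =>
        ⟨by linarith [ht.1], by linarith [ht.2]⟩
  obtain ⟨α, hαa, hα⟩ := exists_solution_of_bounded_lipschitz hF hM hab hg (u a)
  let v : ℝ → Fin n → ℝ := fun t => if t ≤ a then u t else α t
  have hvu : ∀ t ≤ a, v t = u t := fun t ht => if_pos ht
  have hvα : ∀ t, a ≤ t → v t = α t := by
    intro t ht
    rcases ht.eq_or_lt with rfl | h
    · rw [hvu _ le_rfl, hαa]
    · exact if_neg (not_le.2 h)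
  refine ⟨v, ⟨?_, fun t ht => (hvu t (ht.trans hta)).trans (hu.initial t ht), ?_⟩, hvu⟩
  · have h1 : ContinuousOn v (Icc (t₀ - 2 * tau) a) :=
      hu.continuousOn.congr fun t ht => hvu t ht.2
    have h2 : ContinuousOn v (Icc a b) :=
      ContinuousOn.congr (fun t ht => (hα t ht).continuousWithinAt) fun t ht => hvα t ht.1
    have h3 := h1.union_of_isClosed h2 isClosed_Icc isClosed_Icc
    rwa [Icc_union_Icc_eq_Icc (by linarith) hab] at h3
  · intro t ht
    rcases lt_or_ge t a with h | h
    · rw [hvu t h.le, hvu _ (by linarith), hvu _ (by linarith)]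
      refine (hu.equation t ⟨ht.1, h⟩).congr_of_eventuallyEq ?_ (hvu t h.le)
      exact nhdsWithin_le_nhds ((eventually_lt_nhds h).mono fun s hs => hvu s hs.le)
    · have h1 := hα t ⟨h, ht.2.le⟩
      rw [hvα t h, hvu _ (by linarith [ht.2]), hvu _ (by linarith [ht.2]), hK t ⟨h, ht.2⟩]
      have h2 : HasDerivWithinAt α (F (α t) + Ka.mulVec (u (t - 2 * tau) - u (t - tau)))
          (Ici t) t :=
        h1.mono_of_mem_nhdsWithin (Filter.mem_of_superset (Icc_mem_nhdsGE ht.2)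
          (Icc_subset_Icc_left h))
      exact h2.congr (fun s hs => hvα s (h.trans hs)) (hvα t h)

/-- The gain jumps only at multiples of `tau`; the residue of `j` modulo 3 decides its value. -/
theorem exists_periodicGain_eq_on_Ico (htau : 0 < tau) (K : Matrix (Fin n) (Fin n) ℝ) (j : ℕ) :
    ∃ Kj, ∀ t ∈ Ico (j * tau) ((j + 1) * tau), periodicGain tau K t = Kj := by
  have hj := Nat.div_add_mod j 3
  have hj' : (j : ℝ) = 3 * ((j / 3 : ℕ) : ℝ) + ((j % 3 : ℕ) : ℝ) := by exact_mod_cast hj.symm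
  have hlt := Nat.mod_lt j (show 0 < 3 by norm_num)
  rcases Nat.lt_or_ge (j % 3) 2 with h | h
  · refine ⟨(0 : ℝ) • K, fun t ht => ?_⟩
    have h1 : ((j % 3 : ℕ) : ℝ) + 1 ≤ 2 := by exact_mod_cast h
    have h0 : (0 : ℝ) ≤ ((j % 3 : ℕ) : ℝ) := Nat.cast_nonneg _
    rw [periodicGain_eq_smul, gainSwitch_eq_zero (k := j / 3) htau]
    · exact le_trans (mul_le_mul_of_nonneg_right (by linarith) htau.le) ht.1
    · exact ht.2.trans_le (mul_le_mul_of_nonneg_right (by linarith) htau.le)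
  · refine ⟨(1 : ℝ) • K, fun t ht => ?_⟩
    have h1 : j % 3 = 2 := by omega
    rw [h1] at hj'
    push_cast at hj'
    rw [periodicGain_eq_smul, gainSwitch_eq_one (k := j / 3)]
    · exact le_trans (mul_le_mul_of_nonneg_right (by linarith) htau.le) ht.1
    · exact ht.2.trans_le (mul_le_mul_of_nonneg_right (by linarith) htau.le)

/-- Global existence for the controlled equation with a bounded Lipschitz field. -/
theorem exists_isControlledSolution {L : NNReal} {M : ℝ} (hF : LipschitzWith L F)
    (hM : ∀ x, ‖F x‖ ≤ M) (htau : 0 < tau) (ht₀ : 0 ≤ t₀)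
    (hφ : ContinuousOn φ (Icc (t₀ - 2 * tau) t₀)) :
    ∃ x, IsControlledSolution F tau K t₀ φ (Ici t₀) x := by
  -- Step endpoints on the grid of multiples of `tau`, so that no jump of the gain lies inside a
  -- step. Steps that end before `t₀` are degenerate.
  let a : ℕ → ℝ := fun j => max t₀ (j * tau)
  have ha0 : a 0 = t₀ := by simp [a, ht₀]
  have hat : ∀ j, t₀ ≤ a j := fun j => le_max_left _ _
  have hamono : Monotone a := fun i j hij =>
    max_le_max_left _ (mul_le_mul_of_nonneg_right (Nat.cast_le.2 hij) htau.le)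
  have hstep : ∀ j u, IsSolutionUpTo F tau K t₀ φ (a j) u →
      ∃ v, IsSolutionUpTo F tau K t₀ φ (a (j + 1)) v ∧ ∀ t ≤ a j, v t = u t := by
    intro j u hu
    obtain ⟨Kj, hKj⟩ := exists_periodicGain_eq_on_Ico htau K j
    refine hu.exists_extension hF hM htau (hat j) (hamono (Nat.le_succ j)) ?_ (Ka := Kj) ?_
    · refine max_le ?_ ?_
      · linarith [hat j]
      · have : (j : ℝ) * tau ≤ a j := le_max_right _ _
        push_cast; linarith
    · intro t ht
      refine hKj t ⟨(le_max_right _ _).trans ht.1, ?_⟩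
      have h1 : t < max t₀ (((j + 1 : ℕ) : ℝ) * tau) := ht.2
      rcases lt_max_iff.1 h1 with h2 | h2
      · exact absurd h2 (not_lt.2 ((hat j).trans ht.1))
      · exact_mod_cast h2
  have hbase : IsSolutionUpTo F tau K t₀ φ (a 0) φ := by
    rw [ha0]
    exact ⟨hφ, fun _ _ => rfl, fun t ht => absurd ht (by simp)⟩
  choose! next hnext hagree using hstep
  let U : ℕ → ℝ → Fin n → ℝ := fun j => Nat.rec φ (fun j u => next j u) j
  have hU : ∀ j, IsSolutionUpTo F tau K t₀ φ (a j) (U j) := by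
    intro j
    induction j with
    | zero => exact hbase
    | succ j ih => exact hnext j _ ih
  have hUle : ∀ i j, i ≤ j → ∀ t ≤ a i, U j t = U i t := by
    intro i j hij
    induction j, hij using Nat.le_induction with
    | base => exact fun _ _ => rfl
    | succ j hij ih =>
      intro t ht
      rw [← ih t ht]
      exact hagree j _ (hU j) t (ht.trans (hamono hij))
  have hUeq : ∀ i j t, t ≤ a i → t ≤ a j → U i t = U j t := by
    intro i j t hi hj
    rcases le_total i j with h | h
    · exact (hUle i j h t hi).symm
    · exact hUle j i h t hj
  have hreach : ∀ t, t ≤ a ⌈t / tau⌉₊ := fun t =>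
    le_trans ((div_le_iff₀ htau).1 (Nat.le_ceil _)) (le_max_right _ _)
  let x : ℝ → Fin n → ℝ := fun t => U ⌈t / tau⌉₊ t
  have hx : ∀ j t, t ≤ a j → x t = U j t := fun j t ht => hUeq _ _ t (hreach t) ht
  have hlt : ∀ t, ∃ j, t < a j := fun t =>
    ⟨⌈(t + 1) / tau⌉₊, lt_of_lt_of_le (by linarith) (hreach (t + 1))⟩
  refine ⟨x, ?_, ?_, ?_⟩
  · intro t ht
    obtain ⟨j, hj⟩ := hlt t
    have htlow : t₀ - 2 * tau ≤ t := by
      rcases ht with h | h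
      · exact h.1
      · exact le_trans (by linarith) (mem_Ici.1 h)
    have h1 : ContinuousWithinAt (U j) (Ici (t₀ - 2 * tau)) t := by
      refine ((hU j).continuousOn t ⟨htlow, hj.le⟩).mono_of_mem_nhdsWithin ?_
      rw [← Ici_inter_Iic]
      exact inter_mem self_mem_nhdsWithin (nhdsWithin_le_nhds (Iic_mem_nhds hj))
    have h2 : ContinuousWithinAt x (Ici (t₀ - 2 * tau)) t := by
      refine h1.congr_of_eventuallyEq ?_ (hx j t hj.le)
      exact nhdsWithin_le_nhds ((eventually_lt_nhds hj).mono fun s hs => hx j s hs.le)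
    refine h2.mono (union_subset Icc_subset_Ici_self (Ici_subset_Ici.2 (by linarith)))
  · intro t ht
    exact hx 0 t (by rw [ha0]; exact ht.2)
  · intro t ht
    obtain ⟨j, hj⟩ := hlt t
    rw [hx j t hj.le, hx j _ (by linarith), hx j _ (by linarith)]
    refine ((hU j).equation t ⟨ht, hj⟩).congr_of_eventuallyEq ?_ (hx j t hj.le)
    exact nhdsWithin_le_nhds ((eventually_lt_nhds hj).mono fun s hs => hx j s hs.le)

/-- A field that is Lipschitz on a closed ball agrees there with a bounded Lipschitz field. -/
theorem exists_bounded_lipschitz_extension {f : (Fin n → ℝ) → (Fin n → ℝ)} {xs : Fin n → ℝ}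
    {r : ℝ} (hr : 0 ≤ r) {L : NNReal} (hf : LipschitzOnWith L f (Metric.closedBall xs r)) :
    ∃ F : (Fin n → ℝ) → (Fin n → ℝ), LipschitzWith L F ∧ (∃ M, ∀ x, ‖F x‖ ≤ M) ∧
      EqOn F f (Metric.closedBall xs r) := by
  -- In the maximum norm a closed ball is a cube, and clamping each coordinate is a 1-Lipschitz
  -- retraction onto it.
  let c : (Fin n → ℝ) → (Fin n → ℝ) := fun x i => max (xs i - r) (min (xs i + r) (x i))
  have hc : LipschitzWith 1 c := LipschitzWith.of_dist_le_mul fun x y => by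
    rw [NNReal.coe_one, one_mul]
    refine (dist_pi_le_iff dist_nonneg).2 fun i => ?_
    have h := ((LipschitzWith.eval i (α := fun _ : Fin n => ℝ)).const_min (xs i + r)).const_max
      (xs i - r)
    simpa using h.dist_le_mul x y
  have hcB : ∀ x, c x ∈ Metric.closedBall xs r := fun x => by
    refine (dist_pi_le_iff hr).2 fun i => ?_
    rw [Real.dist_eq, abs_le]
    constructor
    · have := le_max_left (xs i - r) (min (xs i + r) (x i))
      simp only [c]; linarith
    · have : max (xs i - r) (min (xs i + r) (x i)) ≤ xs i + r :=
        max_le (by linarith) (min_le_left _ _)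
      simp only [c]; linarith
  have hcid : ∀ x ∈ Metric.closedBall xs r, c x = x := fun x hx => by
    funext i
    have h := (dist_pi_le_iff hr).1 hx i
    rw [Real.dist_eq, abs_le] at h
    simp only [c]
    rw [min_eq_right (by linarith), max_eq_right (by linarith)]
  refine ⟨f ∘ c, ?_, ⟨‖f xs‖ + L * r, fun x => ?_⟩, fun x hx => by simp [hcid x hx]⟩
  · have := hf.comp (hc.lipschitzOnWith (s := univ)) fun x _ => hcB x
    rw [mul_one] at this
    exact lipschitzOnWith_univ.1 this
  · have h1 := hf.norm_sub_le (hcB x) (Metric.mem_closedBall_self hr)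
    have h2 : ‖c x - xs‖ ≤ r := by rw [← dist_eq_norm]; exact hcB x
    have h3 := norm_le_insert' (f (c x)) (f xs)
    have h4 : (L : ℝ) * ‖c x - xs‖ ≤ L * r := by gcongr
    simp only [Function.comp]
    linarith

end TDFC

end

noncomputable section

namespace TDFC

/-! ### Multipliers of the controlled modes -/

/-- The multiplier is affine in the gain with slope `tau (exp(lam tau) - exp(2 lam tau))`, nonzero
for `lam > 0`; `realGain` solves for the value `zeta`. -/
theorem modeMultiplier_realGain {tau lam zeta : ℝ} (htau : 0 < tau) (hlam : 0 < lam) :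
    modeMultiplier tau lam (realGain tau lam zeta) = zeta := by
  have h1 : Real.exp (lam * tau) - 1 ≠ 0 := by
    have : 1 < Real.exp (lam * tau) := Real.one_lt_exp_iff.2 (by positivity)
    linarith
  have h2 : Real.exp (3 * lam * tau) + tau * realGain tau lam zeta *
      (Real.exp (lam * tau) - Real.exp (2 * lam * tau)) = zeta := by
    have e2 : Real.exp (2 * lam * tau) = Real.exp (lam * tau) ^ 2 := by
      rw [← Real.exp_nat_mul]; congr 1; push_cast; ring
    have e3 : Real.exp (-lam * tau) = (Real.exp (lam * tau))⁻¹ := by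
      rw [← Real.exp_neg]; congr 1; ring
    have h3 := (Real.exp_pos (lam * tau)).ne'
    rw [realGain, e2, e3]
    field_simp
    ring
  have h3 := congrArg Complex.ofReal h2
  push_cast at h3
  exact h3

/-- With `W = exp(i om tau)` and `T = exp(i theta)`, the equation "multiplier = `rho T`" gives the
gain `(rho T - r³ W³) / (tau r W (1 - r W))`. Making the denominator real with the conjugate factor
`1 - r W⁻¹` and splitting into real and imaginary parts gives the two stated formulas. The
denominator contains `D = |1 - r W|²`, positive because `r > 1`. -/
theorem modeMultiplier_complexGain {tau mu om rho theta : ℝ} (htau : 0 < tau) (hmu : 0 < mu) :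
    modeMultiplier tau (mu + om * Complex.I)
      (complexGain₁ tau mu om rho theta + complexGain₂ tau mu om rho theta * Complex.I) =
      rho * Complex.exp (theta * Complex.I) := by
  set r : ℝ := Real.exp (mu * tau) with hr
  have hr1 : 1 < r := Real.one_lt_exp_iff.2 (by positivity)
  set D : ℝ := 1 - 2 * r * Real.cos (om * tau) + r ^ 2 with hD
  have hD0 : 0 < D := by nlinarith [Real.cos_le_one (om * tau)]
  set W : ℂ := Complex.exp (om * tau * Complex.I) with hW
  set W' : ℂ := Complex.exp (-(om * tau) * Complex.I) with hW'
  set T : ℂ := Complex.exp (theta * Complex.I) with hT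
  have hWW : W * W' = 1 := by
    rw [hW, hW', ← Complex.exp_add]; simp
  have hexp : ∀ x : ℝ, (Real.cos x : ℂ) + Real.sin x * Complex.I = Complex.exp (x * Complex.I) := by
    intro x; rw [Complex.exp_mul_I]; simp
  have hDW : (D : ℂ) = (1 - r * W) * (1 - r * W') := by
    have h1 : W + W' = 2 * (Real.cos (om * tau) : ℂ) := by
      have h2 := hexp (om * tau)
      have h3 := hexp (-(om * tau))
      rw [Real.cos_neg, Real.sin_neg] at h3
      push_cast at h2 h3 ⊢
      rw [hW, hW', ← h2, ← h3]; ring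
    rw [hD]; push_cast
    push_cast at h1
    linear_combination (r : ℂ) * h1 - (r : ℂ) ^ 2 * hWW
  have e2 : Real.exp (2 * mu * tau) = r ^ 2 := by
    rw [hr, ← Real.exp_nat_mul]; congr 1; push_cast; ring
  have e3 : Real.exp (3 * mu * tau) = r ^ 3 := by
    rw [hr, ← Real.exp_nat_mul]; congr 1; push_cast; ring
  have e4 : Real.exp (4 * mu * tau) = r ^ 4 := by
    rw [hr, ← Real.exp_nat_mul]; congr 1; push_cast; ring
  have hE : Complex.exp ((mu + om * Complex.I) * tau) = r * W := by
    rw [hr, hW, Complex.ofReal_exp, ← Complex.exp_add]; congr 1; push_cast; ring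
  have hE2 : Complex.exp (2 * (mu + om * Complex.I) * tau) = (r * W) ^ 2 := by
    rw [← hE, ← Complex.exp_nat_mul]; congr 1; push_cast; ring
  have hE3 : Complex.exp (3 * (mu + om * Complex.I) * tau) = (r * W) ^ 3 := by
    rw [← hE, ← Complex.exp_nat_mul]; congr 1; push_cast; ring
  have hden : complexGainDenom tau mu om = tau * r * D := by
    rw [complexGainDenom, e2, ← hr, hD]
  have f1 := hexp (theta - om * tau)
  have f2 := hexp (theta - 2 * om * tau)
  have f3 := hexp (2 * om * tau)
  have f4 := hexp (om * tau)
  have g1 : Complex.exp (((theta - om * tau : ℝ) : ℂ) * Complex.I) = T * W' := by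
    rw [hT, hW', ← Complex.exp_add]; congr 1; push_cast; ring
  have g2 : Complex.exp (((theta - 2 * om * tau : ℝ) : ℂ) * Complex.I) = T * W' ^ 2 := by
    rw [hT, hW', ← Complex.exp_nat_mul, ← Complex.exp_add]; congr 1; push_cast; ring
  have g3 : Complex.exp (((2 * om * tau : ℝ) : ℂ) * Complex.I) = W ^ 2 := by
    rw [hW, ← Complex.exp_nat_mul]; congr 1; push_cast; ring
  have g4 : Complex.exp (((om * tau : ℝ) : ℂ) * Complex.I) = W := by
    rw [hW]; congr 1; push_cast; ring
  rw [g1] at f1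
  rw [g2] at f2
  rw [g3] at f3
  rw [g4] at f4
  have hk : (complexGain₁ tau mu om rho theta : ℂ) + complexGain₂ tau mu om rho theta * Complex.I =
      (rho * T * W' - rho * r * T * W' ^ 2 - r ^ 3 * W ^ 2 + r ^ 4 * W) / (tau * r * D) := by
    rw [complexGain₁, complexGain₂, hden, e3, e4, ← hr, Complex.ofReal_div, Complex.ofReal_div,
      div_mul_eq_mul_div, ← add_div]
    congr 1
    · simp only [Complex.ofReal_add, Complex.ofReal_sub, Complex.ofReal_mul, Complex.ofReal_pow]
      linear_combination (rho : ℂ) * f1 - rho * r * f2 - r ^ 3 * f3 + r ^ 4 * f4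
    · push_cast; ring
  rw [modeMultiplier, hk, hE, hE2, hE3]
  have htau' : (tau : ℂ) ≠ 0 := by exact_mod_cast htau.ne'
  have hr' : (r : ℂ) ≠ 0 := by exact_mod_cast (by linarith : r ≠ 0)
  have hD' : (D : ℂ) ≠ 0 := by exact_mod_cast hD0.ne'
  field_simp
  rw [hDW]
  linear_combination (1 - r * W) * (rho * T - rho * r * T * W') * hWW -
    (1 - r * W) * r ^ 4 * W ^ 2 * hWW

theorem norm_modeMultiplier_zero_lt_one {tau : ℝ} (htau : 0 < tau) {L : ℂ} (hL : L.re < 0) :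
    ‖modeMultiplier tau L 0‖ < 1 := by
  have : modeMultiplier tau L 0 = Complex.exp (3 * L * tau) := by simp [modeMultiplier]
  rw [this, Complex.norm_exp, Real.exp_lt_one_iff]
  have : (3 * L * tau).re = 3 * L.re * tau := by simp
  rw [this]
  nlinarith [mul_pos_of_neg_of_neg hL (neg_lt_zero.2 htau)]

end TDFC

end

noncomputable section

namespace TDFC

/-! ### Complex coordinates adapted to a real Jordan form -/

variable {m p n : ℕ}

/-- The complex coordinate of a pair of real coordinates. -/
def pairCoord (y : BlockIndex m p → ℝ) (i : Fin p) : ℂ :=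
  y (Sum.inr (i, 0)) + y (Sum.inr (i, 1)) * Complex.I

/-- Complex coordinates, one for each block; the coordinate of the `i`-th block is scaled
by `s ^ i`. -/
def scaledCoords (s : ℝ) : (BlockIndex m p → ℝ) →ₗ[ℝ] (Fin m ⊕ Fin p → ℂ) where
  toFun y := Sum.elim (fun i => (s : ℂ) ^ (i : ℕ) * y (Sum.inl i))
    fun i => (s : ℂ) ^ (i : ℕ) * pairCoord y i
  map_add' y y' := by
    funext i
    rcases i with i | i <;> simp [pairCoord] <;> ring
  map_smul' c y := by
    funext i
    rcases i with i | i <;> simp [pairCoord] <;> ring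

theorem scaledCoords_inl (s : ℝ) (y : BlockIndex m p → ℝ) (i : Fin m) :
    scaledCoords s y (Sum.inl i) = (s : ℂ) ^ (i : ℕ) * y (Sum.inl i) := rfl

theorem scaledCoords_inr (s : ℝ) (y : BlockIndex m p → ℝ) (i : Fin p) :
    scaledCoords s y (Sum.inr i) = (s : ℂ) ^ (i : ℕ) * pairCoord y i := rfl

theorem scaledCoords_injective {s : ℝ} (hs : s ≠ 0) :
    Function.Injective (scaledCoords (m := m) (p := p) s) := by
  refine (injective_iff_map_eq_zero _).2 fun y hy => ?_
  have hs' : ∀ k : ℕ, (s : ℂ) ^ k ≠ 0 := fun k => pow_ne_zero _ (by exact_mod_cast hs)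
  funext b
  rcases b with i | ⟨i, a⟩
  · have h := congrFun hy (Sum.inl i)
    rw [scaledCoords_inl] at h
    simpa [hs'] using h
  · have h := congrFun hy (Sum.inr i)
    rw [scaledCoords_inr] at h
    have h1 : pairCoord y i = 0 := by simpa [hs'] using h
    have hre := congrArg Complex.re h1
    have him := congrArg Complex.im h1
    simp [pairCoord] at hre him
    fin_cases a
    · exact hre
    · exact him

theorem blockDiag_mulVec_inl (d : Fin m → ℝ) (B : Fin p → Matrix (Fin 2) (Fin 2) ℝ)
    (y : BlockIndex m p → ℝ) (i : Fin m) :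
    (blockDiag d B).mulVec y (Sum.inl i) = d i * y (Sum.inl i) := by
  simp [blockDiag, Matrix.mulVec, dotProduct, Fintype.sum_sum_type, Matrix.diagonal_apply]

theorem blockDiag_mulVec_inr (d : Fin m → ℝ) (B : Fin p → Matrix (Fin 2) (Fin 2) ℝ)
    (y : BlockIndex m p → ℝ) (i : Fin p) (a : Fin 2) :
    (blockDiag d B).mulVec y (Sum.inr (i, a)) =
      B i a 0 * y (Sum.inr (i, 0)) + B i a 1 * y (Sum.inr (i, 1)) := by
  simp [blockDiag, Matrix.mulVec, dotProduct, Fintype.sum_sum_type, Fintype.sum_prod_type,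
    Fin.sum_univ_two]

/-- Block-diagonal matrices with rotation-scaling blocks become diagonal. -/
theorem scaledCoords_blockDiag_mulVec (s : ℝ) (d : Fin m → ℝ) (a b : Fin p → ℝ)
    (y : BlockIndex m p → ℝ) :
    scaledCoords s ((blockDiag d fun i => rotBlock (a i) (b i)).mulVec y) =
      Sum.elim (fun i => (d i : ℂ)) (fun i => a i + b i * Complex.I) * scaledCoords s y := by
  funext i
  rcases i with i | i
  · rw [Pi.mul_apply, scaledCoords_inl, scaledCoords_inl, blockDiag_mulVec_inl]
    simp only [Sum.elim_inl]
    push_cast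
    ring
  · rw [Pi.mul_apply, scaledCoords_inr, scaledCoords_inr, pairCoord, pairCoord,
      blockDiag_mulVec_inr, blockDiag_mulVec_inr]
    simp only [Sum.elim_inr, rotBlock, Matrix.of_apply, Matrix.cons_val_zero, Matrix.cons_val_one,
      Matrix.cons_val', Matrix.cons_val_fin_one]
    push_cast
    linear_combination (-(s : ℂ) ^ (i : ℕ) * b i * y (Sum.inr (i, 1))) * Complex.I_mul_I

variable {lam : Fin m → ℝ} {mu om : Fin p → ℝ}
  {N : Matrix (BlockIndex m p) (BlockIndex m p) ℝ}

/-- A row of `N` has at most one nonzero entry, in the next column. -/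
theorem IsJordanOffDiag.mulVec_inl (hN : IsJordanOffDiag lam mu om N) (y : BlockIndex m p → ℝ)
    (i : Fin m) : N.mulVec y (Sum.inl i) = 0 ∨
      ∃ j : Fin m, (i : ℕ) + 1 = j ∧ N.mulVec y (Sum.inl i) = y (Sum.inl j) := by
  have h0 : N.mulVec y (Sum.inl i) = ∑ j, N (Sum.inl i) (Sum.inl j) * y (Sum.inl j) := by
    simp [Matrix.mulVec, dotProduct, Fintype.sum_sum_type, fun r => (hN.2.1 i r).1]
  by_cases hj : ∃ j, N (Sum.inl i) (Sum.inl j) ≠ 0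
  · obtain ⟨j, hj⟩ := hj
    obtain ⟨h1, -, h2⟩ := (hN.1 i j).resolve_left hj
    refine Or.inr ⟨j, h1, ?_⟩
    rw [h0, Finset.sum_eq_single j, h2, one_mul]
    · intro k _ hk
      rcases hN.1 i k with h | ⟨h, -⟩
      · rw [h, zero_mul]
      · exact absurd (Fin.ext (h.symm.trans h1)) hk
    · simp
  · push Not at hj
    left
    rw [h0]
    simp [hj]

/-- Both coupling conventions meet here. The identity block passes on the next complex coordinate
unchanged; the single `1` passes on its real part as an imaginary part. The latter is not complex
linear, so only a bound on the modulus is claimed. -/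
theorem IsJordanOffDiag.pairCoord_mulVec (hN : IsJordanOffDiag lam mu om N)
    (y : BlockIndex m p → ℝ) (i : Fin p) : pairCoord (N.mulVec y) i = 0 ∨
      ∃ j : Fin p, (i : ℕ) + 1 = j ∧ ‖pairCoord (N.mulVec y) i‖ ≤ ‖pairCoord y j‖ := by
  let S : Fin p → Matrix (Fin 2) (Fin 2) ℝ := fun j =>
    Matrix.of fun a b => N (Sum.inr (i, a)) (Sum.inr (j, b))
  have h0 : ∀ a, N.mulVec y (Sum.inr (i, a)) =
      ∑ j, (S j a 0 * y (Sum.inr (j, 0)) + S j a 1 * y (Sum.inr (j, 1))) := by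
    intro a
    simp [S, Matrix.mulVec, dotProduct, Fintype.sum_sum_type, Fintype.sum_prod_type,
      fun r k => (hN.2.1 k r).2, Fin.sum_univ_two]
  by_cases hj : ∃ j, S j ≠ 0
  · obtain ⟨j, hj⟩ := hj
    obtain ⟨h1, -, -, h2⟩ := (hN.2.2 i j).resolve_left hj
    refine Or.inr ⟨j, h1, ?_⟩
    have h3 : ∀ a, N.mulVec y (Sum.inr (i, a)) =
        S j a 0 * y (Sum.inr (j, 0)) + S j a 1 * y (Sum.inr (j, 1)) := by
      intro a
      rw [h0, Finset.sum_eq_single j]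
      · intro k _ hk
        rcases hN.2.2 i k with h | ⟨h, -⟩
        · have : S k = 0 := h
          simp [this]
        · exact absurd (Fin.ext (h.symm.trans h1)) hk
      · simp
    have h2' : S j = 1 ∨ S j = !![0, 0; 1, 0] := h2
    rw [pairCoord, h3, h3]
    rcases h2' with h | h
    · simp [h, pairCoord]
    · have h4 : |y (Sum.inr (j, 0))| ≤ ‖pairCoord y j‖ := by
        have := Complex.abs_re_le_norm (pairCoord y j)
        simpa [pairCoord] using this
      simpa [h] using h4
  · push Not at hj
    left
    rw [pairCoord, h0, h0]
    simp [hj]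

/-- In the scaled coordinates the nilpotent part is small. -/
theorem IsJordanOffDiag.norm_scaledCoords_mulVec_le (hN : IsJordanOffDiag lam mu om N) {s : ℝ}
    (hs : 0 < s) (y : BlockIndex m p → ℝ) :
    ‖scaledCoords s (N.mulVec y)‖ ≤ s⁻¹ * ‖scaledCoords s y‖ := by
  refine (pi_norm_le_iff_of_nonneg (by positivity)).2 fun i => ?_
  -- `N` moves coordinate `k + 1` to coordinate `k`, whose weight is smaller by the factor `s⁻¹`.
  have hpow : ∀ (k : ℕ) (w w' : ℂ), ‖w‖ ≤ ‖w'‖ →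
      ‖(s : ℂ) ^ k * w‖ ≤ s⁻¹ * ‖(s : ℂ) ^ (k + 1) * w'‖ := by
    intro k w w' hw
    have e : s⁻¹ * ‖(s : ℂ) ^ (k + 1) * w'‖ = ‖(s : ℂ) ^ k‖ * ‖w'‖ := by
      rw [pow_succ, norm_mul, norm_mul, Complex.norm_real, Real.norm_of_nonneg hs.le]
      field_simp
    rw [e, norm_mul]
    gcongr
  rcases i with i | i
  · rw [scaledCoords_inl]
    rcases hN.mulVec_inl y i with h | ⟨j, hj, h⟩
    · rw [h]; simp; positivity
    · rw [h]
      refine (hpow i _ _ le_rfl).trans ?_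
      rw [hj, ← scaledCoords_inl]
      gcongr
      exact norm_le_pi_norm _ _
  · rw [scaledCoords_inr]
    rcases hN.pairCoord_mulVec y i with h | ⟨j, hj, h⟩
    · rw [h]; simp; positivity
    · refine (hpow i _ _ h).trans ?_
      rw [hj, ← scaledCoords_inr]
      gcongr
      exact norm_le_pi_norm _ _

/-- The coordinates of a vector in the Jordan basis. -/
def jordanCoords (h : m + p * 2 = n) (V : Matrix (Fin n) (Fin n) ℝ) :
    (Fin n → ℝ) →ₗ[ℝ] (BlockIndex m p → ℝ) :=
  (LinearMap.funLeft ℝ ℝ (blockEquiv h)).comp V.mulVecLin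

theorem jordanCoords_injective (h : m + p * 2 = n) {V : Matrix (Fin n) (Fin n) ℝ}
    (hV : IsUnit V) : Function.Injective (jordanCoords h V) :=
  (LinearMap.funLeft_injective_of_surjective ℝ ℝ _ (blockEquiv h).surjective).comp
    (Matrix.mulVec_injective_iff_isUnit.2 hV)

theorem jordanCoords_conj_mulVec (h : m + p * 2 = n) {V : Matrix (Fin n) (Fin n) ℝ}
    (hV : IsUnit V) (D : Matrix (BlockIndex m p) (BlockIndex m p) ℝ) (v : Fin n → ℝ) :
    jordanCoords h V ((V⁻¹ * Matrix.reindex (blockEquiv h) (blockEquiv h) D * V).mulVec v) =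
      D.mulVec (jordanCoords h V v) := by
  have hdet : IsUnit V.det := (Matrix.isUnit_iff_isUnit_det V).1 hV
  funext b
  simp only [jordanCoords, LinearMap.comp_apply, Matrix.mulVecLin_apply, LinearMap.funLeft_apply]
  rw [Matrix.mulVec_mulVec, ← Matrix.mul_assoc, Matrix.mul_nonsing_inv_cancel_left _ _ hdet,
    ← Matrix.mulVec_mulVec, Matrix.reindex_apply, Matrix.submatrix_mulVec_equiv]
  simp only [Function.comp_apply, Equiv.symm_apply_apply, Equiv.symm_symm]
  rfl

theorem rotBlock_zero : rotBlock 0 0 = 0 := by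
  ext i j; fin_cases i <;> fin_cases j <;> simp [rotBlock]

/-! ### Eigenvalues of a matrix in real Jordan form -/

/-- The vector `v - i w` is an eigenvector for `a + i b`, nonzero because its real part is `v`.
Taking `b = 0`, `w = 0` covers real eigenvalues. -/
theorem mem_spectrum_of_real_pair {A : Matrix (Fin n) (Fin n) ℝ} {a b : ℝ} {v w : Fin n → ℝ}
    (hv : v ≠ 0) (hAv : A.mulVec v = a • v + b • w) (hAw : A.mulVec w = a • w - b • v) :
    (a + b * Complex.I : ℂ) ∈ spectrum ℂ (A.map (algebraMap ℝ ℂ)) := by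
  rw [spectrum.mem_iff]
  intro hunit
  have hinj := Matrix.mulVec_injective_iff_isUnit.2 hunit
  let c : (Fin n → ℝ) → (Fin n → ℂ) := fun x i => (x i : ℂ)
  have hc : ∀ x, (A.map (algebraMap ℝ ℂ)).mulVec (c x) = c (A.mulVec x) := by
    intro x
    funext i
    simp [c, Matrix.mulVec, dotProduct]
  have hz : (algebraMap ℂ (Matrix (Fin n) (Fin n) ℂ) (a + b * Complex.I) -
      A.map (algebraMap ℝ ℂ)).mulVec (c v - Complex.I • c w) = 0 := by
    rw [Matrix.sub_mulVec, Matrix.mulVec_sub (A.map _), Matrix.mulVec_smul (A.map _), hc, hc, hAv,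
      hAw, Algebra.algebraMap_eq_smul_one, Matrix.smul_mulVec, Matrix.one_mulVec]
    funext i
    simp only [c, Pi.sub_apply, Pi.smul_apply, Pi.add_apply, smul_eq_mul, Pi.zero_apply]
    push_cast
    linear_combination (-(b : ℂ) * w i) * Complex.I_mul_I
  have h0 := hinj (hz.trans (Matrix.mulVec_zero _).symm)
  apply hv
  funext i
  have h1 := congrArg Complex.re (congrFun h0 i)
  simpa [c] using h1

theorem IsRealJordanDecomposition.mem_spectrum_of_pair {h : m + p * 2 = n}
    {A V : Matrix (Fin n) (Fin n) ℝ} (hJ : IsRealJordanDecomposition h A V lam mu om N)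
    {a b : ℝ} {y y' : BlockIndex m p → ℝ} (hy : y ≠ 0)
    (h1 : (blockDiag lam (fun i => rotBlock (mu i) (om i)) + N).mulVec y = a • y + b • y')
    (h2 : (blockDiag lam (fun i => rotBlock (mu i) (om i)) + N).mulVec y' = a • y' - b • y) :
    (a + b * Complex.I : ℂ) ∈ spectrum ℂ (A.map (algebraMap ℝ ℂ)) := by
  obtain ⟨hV, -, -, hA⟩ := hJ
  have hsurj : Function.Surjective (jordanCoords h V) := by
    have hfin : Module.finrank ℝ (Fin n → ℝ) = Module.finrank ℝ (BlockIndex m p → ℝ) := by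
      simp [← h]
    exact (LinearMap.injective_iff_surjective_of_finrank_eq_finrank hfin).1
      (jordanCoords_injective h hV)
  obtain ⟨v, rfl⟩ := hsurj y
  obtain ⟨w, rfl⟩ := hsurj y'
  refine mem_spectrum_of_real_pair (v := v) (w := w) (fun h0 => hy (by rw [h0, map_zero])) ?_ ?_
  · apply jordanCoords_injective h hV
    rw [hA, jordanCoords_conj_mulVec h hV, h1, map_add, map_smul, map_smul]
  · apply jordanCoords_injective h hV
    rw [hA, jordanCoords_conj_mulVec h hV, h2, map_sub, map_smul, map_smul]

/-- Walk back along the Jordan chain: a nonzero entry in the column leads to the preceding index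
with the same eigenvalue, and the walk ends at index `0` at the latest. The basis vector of a zero
column is a genuine eigenvector. -/
theorem IsJordanOffDiag.exists_zero_column_inl (hN : IsJordanOffDiag lam mu om N) :
    ∀ (k : ℕ) (i : Fin m), (i : ℕ) = k →
      ∃ i₀, lam i₀ = lam i ∧ ∀ j, N (Sum.inl j) (Sum.inl i₀) = 0 := by
  intro k
  induction k with
  | zero =>
    intro i hi
    exact ⟨i, rfl, fun j => (hN.1 j i).resolve_right fun h => by omega⟩
  | succ k ih =>
    intro i hi
    by_cases hj : ∃ j, N (Sum.inl j) (Sum.inl i) ≠ 0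
    · obtain ⟨j, hj⟩ := hj
      obtain ⟨h1, h2, -⟩ := (hN.1 j i).resolve_left hj
      obtain ⟨i₀, h3, h4⟩ := ih j (by omega)
      exact ⟨i₀, h3.trans h2, h4⟩
    · push Not at hj
      exact ⟨i, rfl, hj⟩

theorem IsJordanOffDiag.exists_zero_column_inr (hN : IsJordanOffDiag lam mu om N) :
    ∀ (k : ℕ) (i : Fin p), (i : ℕ) = k → ∃ i₀, mu i₀ = mu i ∧ om i₀ = om i ∧
      ∀ j a b, N (Sum.inr (j, a)) (Sum.inr (i₀, b)) = 0 := by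
  intro k
  induction k with
  | zero =>
    intro i hi
    refine ⟨i, rfl, rfl, fun j a b => ?_⟩
    have := (hN.2.2 j i).resolve_right fun h => by omega
    exact congrFun (congrFun this a) b
  | succ k ih =>
    intro i hi
    by_cases hj : ∃ j a b, N (Sum.inr (j, a)) (Sum.inr (i, b)) ≠ 0
    · obtain ⟨j, a, b, hj⟩ := hj
      obtain ⟨h1, h2, h3, -⟩ := (hN.2.2 j i).resolve_left fun h =>
        hj (congrFun (congrFun h a) b)
      obtain ⟨i₀, h4, h5, h6⟩ := ih j (by omega)
      exact ⟨i₀, h4.trans h2, h5.trans h3, h6⟩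
    · push Not at hj
      exact ⟨i, rfl, rfl, hj⟩

theorem IsRealJordanDecomposition.lam_mem_spectrum {h : m + p * 2 = n}
    {A V : Matrix (Fin n) (Fin n) ℝ} (hJ : IsRealJordanDecomposition h A V lam mu om N)
    (i : Fin m) : (lam i : ℂ) ∈ spectrum ℂ (A.map (algebraMap ℝ ℂ)) := by
  have hN := hJ.2.2.1
  obtain ⟨i₀, h1, h2⟩ := hN.exists_zero_column_inl i i rfl
  have key := hJ.mem_spectrum_of_pair (a := lam i₀) (b := 0)
    (y := Pi.single (Sum.inl i₀) 1) (y' := 0) (by simp) ?_ (by simp)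
  · simpa [h1] using key
  · rw [Matrix.add_mulVec, Matrix.mulVec_single_one N]
    funext b
    rcases b with j | ⟨j, a⟩
    · rw [Pi.add_apply, blockDiag_mulVec_inl]
      simp only [Matrix.col_apply, h2, Pi.add_apply, Pi.smul_apply, smul_eq_mul, Pi.zero_apply,
        mul_zero, add_zero, Pi.single_apply, Sum.inl.injEq]
      split_ifs with hji
      · rw [hji]
      · simp
    · rw [Pi.add_apply, blockDiag_mulVec_inr]
      simp [(hN.2.1 i₀ (j, a)).2]

theorem IsRealJordanDecomposition.mu_om_mem_spectrum {h : m + p * 2 = n}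
    {A V : Matrix (Fin n) (Fin n) ℝ} (hJ : IsRealJordanDecomposition h A V lam mu om N)
    (i : Fin p) : (mu i + om i * Complex.I : ℂ) ∈ spectrum ℂ (A.map (algebraMap ℝ ℂ)) := by
  have hN := hJ.2.2.1
  obtain ⟨i₀, h1, h2, h3⟩ := hN.exists_zero_column_inr i i rfl
  rw [← h1, ← h2]
  refine hJ.mem_spectrum_of_pair (y := Pi.single (Sum.inr (i₀, 0)) 1)
    (y' := Pi.single (Sum.inr (i₀, 1)) 1) (by simp) ?_ ?_
  all_goals
    rw [Matrix.add_mulVec, Matrix.mulVec_single_one N]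
    funext b
    rcases b with j | ⟨j, a⟩
    · rw [Pi.add_apply, blockDiag_mulVec_inl]
      simp [(hN.2.1 j _).1]
    · rw [Pi.add_apply, blockDiag_mulVec_inr]
      by_cases hji : j = i₀
      · subst hji
        fin_cases a <;> simp [h3, rotBlock]
      · simp [h3, hji]

end TDFC

end

noncomputable section

namespace TDFC

/-! ### Local asymptotic stability -/

theorem IsControlledSolution.mono {n : ℕ} {f : (Fin n → ℝ) → (Fin n → ℝ)} {tau t₀ : ℝ}
    {K : Matrix (Fin n) (Fin n) ℝ} {φ x : ℝ → Fin n → ℝ} {S S' : Set ℝ}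
    (h : IsControlledSolution f tau K t₀ φ S x) (hS : S' ⊆ S) :
    IsControlledSolution f tau K t₀ φ S' x :=
  ⟨h.continuousOn.mono (union_subset_union_right _ hS), h.initial,
    fun t ht => h.equation t (hS ht)⟩

/-- Trapping principle: a continuous curve stays in the open ball of radius `r` if it cannot
reach the sphere while being inside. -/
theorem norm_lt_of_trapped {E : Type*} [NormedAddCommGroup E] {z : ℝ → E} {t₀ T r : ℝ}
    (hz : ContinuousOn z (Ico t₀ T))
    (htrap : ∀ t ∈ Ico t₀ T, (∀ s ∈ Ico t₀ t, ‖z s‖ < r) → ‖z t‖ < r) :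
    ∀ t ∈ Ico t₀ T, ‖z t‖ < r := by
  intro t ht
  by_contra! hcon
  have hzt : ContinuousOn (fun s => ‖z s‖) (Icc t₀ t) :=
    (hz.mono (Icc_subset_Ico_right ht.2)).norm
  have hcomp : IsCompact (Icc t₀ t ∩ (fun s => ‖z s‖) ⁻¹' Ici r) :=
    isCompact_Icc.of_isClosed_subset (hzt.preimage_isClosed_of_isClosed isClosed_Icc isClosed_Ici)
      inter_subset_left
  -- `u` is the first time outside the open ball; all earlier times are inside, vacuously if `u =
  -- t₀`.
  obtain ⟨u, hu, hmin⟩ := hcomp.exists_isLeast ⟨t, ⟨ht.1, le_rfl⟩, hcon⟩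
  refine absurd (htrap u ⟨hu.1.1, hu.1.2.trans_lt ht.2⟩ fun s hs => ?_) (not_lt.2 hu.2)
  by_contra! hs'
  exact absurd (hmin ⟨⟨hs.1, hs.2.le.trans hu.1.2⟩, hs'⟩) (not_le.2 hs.2)

variable {n : ℕ} {ι : Type*} [Fintype ι] {tau : ℝ} {L κ : ι → ℂ}
  {K : Matrix (Fin n) (Fin n) ℝ} {Φ : (Fin n → ℝ) →ₗ[ℝ] (ι → ℂ)}

/-- In mode coordinates a controlled solution is an approximate mode solution, as long as it stays
where the field is approximated by the diagonal one. -/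
theorem IsControlledSolution.isApproxModeSolution {F : (Fin n → ℝ) → (Fin n → ℝ)}
    {xs : Fin n → ℝ} {η r δ t₀ T t₁ : ℝ} {φ x : ℝ → Fin n → ℝ}
    (hx : IsControlledSolution F tau K t₀ φ (Ico t₀ T) x)
    (hK : ∀ v, Φ (K.mulVec v) = κ * Φ v)
    (hF : ∀ v, ‖Φ v‖ < r → ‖Φ (F (xs + v)) - L * Φ v‖ ≤ η * ‖Φ v‖)
    (hhist : ∀ s ∈ Icc (t₀ - 2 * tau) t₀, ‖Φ (x s - xs)‖ ≤ δ) (ht₁ : t₁ ∈ Ico t₀ T)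
    (hr : ∀ s ∈ Ico t₀ t₁, ‖Φ (x s - xs)‖ < r) :
    IsApproxModeSolution tau L κ η t₀ t₁ δ (fun t => Φ (F (x t))) fun t => Φ (x t - xs) where
  continuousOn := by
    refine (Φ.continuous_of_finiteDimensional).comp_continuousOn
      (ContinuousOn.sub (hx.continuousOn.mono ?_) continuousOn_const)
    intro t ht
    rcases le_total t t₀ with h | h
    · exact Or.inl ⟨ht.1, h⟩
    · exact Or.inr ⟨h, ht.2.trans_lt ht₁.2⟩
  history := hhist
  equation := by
    intro t ht
    have h1 := (hx.equation t ⟨ht.1, ht.2.trans ht₁.2⟩).sub_const xs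
    have h2 := (LinearMap.toContinuousLinearMap Φ).hasFDerivAt.comp_hasDerivWithinAt t h1
    refine h2.congr_deriv ?_
    simp only [LinearMap.coe_toContinuousLinearMap', map_add]
    rw [periodicGain_eq_smul, Matrix.smul_mulVec, map_smul, hK, ← map_sub]
    congr 4
    abel
  error := by
    intro t ht
    have := hF (x t - xs) (hr t ht)
    rwa [add_sub_cancel] at this

/-- Local asymptotic stability from approximately diagonalizing mode coordinates. -/
theorem isLocallyAsymptoticallyStable_of_modes {f : (Fin n → ℝ) → (Fin n → ℝ)}
    {xs : Fin n → ℝ} {A : Matrix (Fin n) (Fin n) ℝ} {rad : ℝ} (hrad : 0 < rad) {Lip : NNReal}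
    (hLip : LipschitzOnWith Lip f (Metric.closedBall xs rad)) (hA : IsJacobianAt f A xs)
    (hxs : f xs = 0) (htau : 0 < tau) (hmult : ∀ i, ‖modeMultiplier tau (L i) (κ i)‖ < 1)
    (hΦ : ∀ η > 0, ∃ Φ : (Fin n → ℝ) →ₗ[ℝ] (ι → ℂ), Function.Injective Φ ∧
      (∀ v, Φ (K.mulVec v) = κ * Φ v) ∧ ∀ v, ‖Φ (A.mulVec v) - L * Φ v‖ ≤ η * ‖Φ v‖) :
    IsLocallyAsymptoticallyStable f tau K xs := by
  obtain ⟨η, hη, q, hq0, hq1, G, hG, hdecay⟩ := exists_decay_of_modeMultiplier_lt_one htau hmult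
  -- Half of the admissible error is spent on the off-diagonal part of `A`, the other half on the
  -- nonlinear remainder.
  obtain ⟨Φ, hinj, hK, hAΦ⟩ := hΦ (η / 2) (half_pos hη)
  obtain ⟨C₁, hC₁, hΦle⟩ : ∃ C > 0, ∀ v, ‖Φ v‖ ≤ C * ‖v‖ :=
    ⟨‖LinearMap.toContinuousLinearMap Φ‖ + 1, by positivity, fun v => by
      have := (LinearMap.toContinuousLinearMap Φ).le_opNorm v
      rw [LinearMap.coe_toContinuousLinearMap'] at this
      nlinarith [norm_nonneg v]⟩
  obtain ⟨C₂, hC₂, hleΦ⟩ : ∃ C > 0, ∀ v, ‖v‖ ≤ C * ‖Φ v‖ := by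
    obtain ⟨C, hC, hanti⟩ := Φ.injective_iff_antilipschitz.1 hinj
    exact ⟨C, hC, fun v => by simpa using hanti.le_mul_dist v 0⟩
  obtain ⟨r, hr, hfr⟩ : ∃ r > 0, ∀ v, ‖Φ v‖ < r →
      ‖Φ (f (xs + v)) - L * Φ v‖ ≤ η * ‖Φ v‖ := by
    have hc : 0 < η / 2 / (C₁ * C₂) := by positivity
    have h1 := (hasFDerivAt_iff_isLittleO_nhds_zero.1 hA).bound hc
    obtain ⟨r, hr, hball⟩ := Metric.eventually_nhds_iff.1 h1
    refine ⟨r / C₂, by positivity, fun v hv => ?_⟩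
    have hvr : ‖v‖ < r := (hleΦ v).trans_lt ((lt_div_iff₀' hC₂).1 hv)
    have h2 := @hball v (by simpa using hvr)
    rw [hxs, sub_zero, LinearMap.coe_toContinuousLinearMap', Matrix.mulVecLin_apply] at h2
    have h3 : ‖Φ (f (xs + v) - A.mulVec v)‖ ≤ η / 2 * ‖Φ v‖ := by
      calc _ ≤ C₁ * (η / 2 / (C₁ * C₂) * (C₂ * ‖Φ v‖)) := by
            refine (hΦle _).trans ?_
            have := hleΦ v
            gcongr
            exact h2.trans (by gcongr)
        _ = η / 2 * ‖Φ v‖ := by field_simp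
    have h4 : Φ (f (xs + v)) - L * Φ v =
        Φ (f (xs + v) - A.mulVec v) + (Φ (A.mulVec v) - L * Φ v) := by
      rw [map_sub]; ring
    rw [h4]
    refine (norm_add_le _ _).trans ?_
    linarith [hAΦ v]
  -- Stated for a general field `F`, since it is needed both for `f` and for its bounded
  -- replacement; only the approximation near `xs` enters. As `G * δ < ρ`, the decay estimate itself
  -- prevents the solution from reaching the boundary of the region.
  have apriori : ∀ (F : (Fin n → ℝ) → (Fin n → ℝ)) (ρ : ℝ),
      (∀ v, ‖Φ v‖ < ρ → ‖Φ (F (xs + v)) - L * Φ v‖ ≤ η * ‖Φ v‖) → ∀ δ, G * δ < ρ →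
      ∀ t₀ ≥ 0, ∀ φ, IsSmallHistory tau t₀ xs (δ / C₁) φ → ∀ T x,
        IsControlledSolution F tau K t₀ φ (Ico t₀ T) x → ∀ t ∈ Ico t₀ T,
        ‖Φ (x t - xs)‖ ≤ G * δ ∧
          ∀ k : ℕ, t₀ + 3 * (k + 1) * tau ≤ t → ‖Φ (x t - xs)‖ ≤ G * q ^ k * δ := by
    intro F ρ hF δ hδ t₀ ht₀ φ hφ T x hx
    have hhist : ∀ s ∈ Icc (t₀ - 2 * tau) t₀, ‖Φ (x s - xs)‖ ≤ δ := by
      intro s hs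
      rw [hx.initial hs]
      have h1 := (lt_div_iff₀' hC₁).1 (hφ.2 s hs)
      exact (hΦle _).trans h1.le
    have hstep : ∀ t ∈ Ico t₀ T, (∀ s ∈ Ico t₀ t, ‖Φ (x s - xs)‖ < ρ) →
        ‖Φ (x t - xs)‖ ≤ G * δ ∧
          ∀ k : ℕ, t₀ + 3 * (k + 1) * tau ≤ t → ‖Φ (x t - xs)‖ ≤ G * q ^ k * δ :=
      fun t ht hs => hdecay t₀ t δ _ _ ht₀ (hx.isApproxModeSolution hK hF hhist ht hs) t
        ⟨ht.1, le_rfl⟩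
    have hin := norm_lt_of_trapped (z := fun t => Φ (x t - xs)) (r := ρ)
      ((Φ.continuous_of_finiteDimensional).comp_continuousOn
        (ContinuousOn.sub (hx.continuousOn.mono subset_union_right) continuousOn_const))
      (fun t ht hs => (hstep t ht hs).1.trans_lt hδ)
    exact fun t ht => hstep t ht fun s hs => hin s ⟨hs.1, hs.2.trans ht.2⟩
  refine ⟨fun ε hε => ?_, ?_⟩
  · set δ : ℝ := min (r / 2) (ε / (2 * C₂)) / G with hδ
    have hδ0 : 0 < δ := by positivity
    have hGδ : G * δ = min (r / 2) (ε / (2 * C₂)) := by rw [hδ]; field_simp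
    refine ⟨δ / C₁, by positivity, fun t₀ ht₀ φ hφ T _ x hx t ht => ?_⟩
    have h1 := (apriori f r hfr δ (by rw [hGδ]; exact (min_le_left _ _).trans_lt (by linarith))
      t₀ ht₀ φ hφ T x hx t ht).1
    have h2 : G * δ ≤ ε / (2 * C₂) := hGδ.trans_le (min_le_right _ _)
    calc ‖x t - xs‖ ≤ C₂ * (ε / (2 * C₂)) := (hleΦ _).trans (by gcongr; exact h1.trans h2)
      _ = ε / 2 := by field_simp
      _ < ε := by linarith
  · obtain ⟨F, hFL, ⟨M, hM⟩, hFf⟩ := exists_bounded_lipschitz_extension hrad.le hLip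
    -- Within `‖Φ v‖ < ρ` both the linear approximation and the equality of `F` with `f` hold, so a
    -- solution for `F` trapped there also solves the equation for `f`.
    set ρ : ℝ := min r (rad / C₂) with hρ
    have hρ0 : 0 < ρ := by positivity
    have hball : ∀ v, ‖Φ v‖ < ρ → xs + v ∈ Metric.closedBall xs rad := by
      intro v hv
      rw [mem_closedBall_iff_norm, add_sub_cancel_left]
      have h1 := (lt_div_iff₀' hC₂).1 (hv.trans_le (min_le_right _ _))
      exact (hleΦ v).trans h1.le
    have hFr : ∀ v, ‖Φ v‖ < ρ → ‖Φ (F (xs + v)) - L * Φ v‖ ≤ η * ‖Φ v‖ := by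
      intro v hv
      rw [hFf (hball v hv)]
      exact hfr v (hv.trans_le (min_le_left _ _))
    set δ : ℝ := ρ / 2 / G with hδ
    have hδ0 : 0 < δ := by positivity
    have hGδ : G * δ < ρ := by
      have : G * δ = ρ / 2 := by rw [hδ]; field_simp
      linarith
    refine ⟨δ / C₁, by positivity, fun t₀ ht₀ φ hφ => ⟨?_, fun x hx => ?_⟩⟩
    · obtain ⟨x, hx⟩ := exists_isControlledSolution (K := K) hFL hM htau ht₀ hφ.1
      refine ⟨x, hx.continuousOn, hx.initial, fun t ht => ?_⟩
      have h1 := (apriori F ρ hFr δ hGδ t₀ ht₀ φ hφ (t + 1) x (hx.mono Ico_subset_Ici_self) t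
        ⟨ht, by linarith⟩).1
      have h2 := hFf (hball _ (h1.trans_lt hGδ))
      rw [add_sub_cancel] at h2
      rw [← h2]
      exact hx.equation t ht
    · have hdec : ∀ t ∈ Ici t₀, ∀ k : ℕ, t₀ + 3 * (k + 1) * tau ≤ t →
          ‖Φ (x t - xs)‖ ≤ G * q ^ k * δ := fun t ht =>
        (apriori f r hfr δ (hGδ.trans_le (min_le_left _ _)) t₀ ht₀ φ hφ (t + 1) x
          (hx.mono Ico_subset_Ici_self) t ⟨ht, by linarith⟩).2
      rw [Metric.tendsto_atTop]
      intro ε hε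
      obtain ⟨k, hk⟩ := exists_pow_lt_of_lt_one (show 0 < ε / (C₂ * G * δ) by positivity) hq1
      refine ⟨t₀ + 3 * (k + 1) * tau, fun t ht => ?_⟩
      have hk0 : 0 ≤ 3 * ((k : ℝ) + 1) * tau := by positivity
      rw [dist_eq_norm]
      calc ‖x t - xs‖ ≤ C₂ * (G * q ^ k * δ) :=
            (hleΦ _).trans (mul_le_mul_of_nonneg_left
              (hdec t (mem_Ici.2 (by linarith)) k ht) hC₂.le)
        _ = q ^ k * (C₂ * G * δ) := by ring
        _ < ε := (lt_div_iff₀ (by positivity)).1 hk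

/-- The complex eigenvalues of the blocks of a real Jordan form. -/
def blockModes {m p : ℕ} (lam : Fin m → ℝ) (mu om : Fin p → ℝ) : Fin m ⊕ Fin p → ℂ :=
  Sum.elim (fun i => (lam i : ℂ)) fun i => mu i + om i * Complex.I

theorem IsRealJordanDecomposition.isLocallyAsymptoticallyStable {m p : ℕ} {h : m + p * 2 = n}
    {f : (Fin n → ℝ) → (Fin n → ℝ)} {xs : Fin n → ℝ} {A V : Matrix (Fin n) (Fin n) ℝ}
    {lam : Fin m → ℝ} {mu om : Fin p → ℝ} {N : Matrix (BlockIndex m p) (BlockIndex m p) ℝ}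
    (hJ : IsRealJordanDecomposition h A V lam mu om N) (hf : PiecewiseC1At f xs)
    (hA : IsJacobianAt f A xs) (hxs : f xs = 0) (hhyp : IsHyperbolic A) (htau : 0 < tau)
    {zeta : Fin m → ℝ} (hzeta : ∀ i, |zeta i| < 1) {rho theta : Fin p → ℝ}
    (hrho : ∀ i, 0 ≤ rho i ∧ rho i < 1) :
    IsLocallyAsymptoticallyStable f tau (V⁻¹ * gainTilde h tau lam mu om zeta rho theta * V)
      xs := by
  obtain ⟨rad, hrad, Lip, hLip⟩ := hf.exists_lipschitzOnWith
  -- Hyperbolicity enters only here: no block has zero real part, so each is either stable with zero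
  -- gain or unstable with the prescribed gain.
  have hlam : ∀ i, lam i ≠ 0 := fun i => by simpa using hhyp _ (hJ.lam_mem_spectrum i)
  have hmu : ∀ i, mu i ≠ 0 := fun i => by simpa using hhyp _ (hJ.mu_om_mem_spectrum i)
  let d : Fin m → ℝ := fun i => if 0 < lam i then realGain tau (lam i) (zeta i) else 0
  let a : Fin p → ℝ := fun i =>
    if 0 < mu i then complexGain₁ tau (mu i) (om i) (rho i) (theta i) else 0
  let b : Fin p → ℝ := fun i =>
    if 0 < mu i then complexGain₂ tau (mu i) (om i) (rho i) (theta i) else 0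
  have hgain : gainTilde h tau lam mu om zeta rho theta =
      Matrix.reindex (blockEquiv h) (blockEquiv h)
        (blockDiag d fun i => rotBlock (a i) (b i)) := by
    unfold gainTilde
    congr 2
    funext i
    by_cases hi : 0 < mu i <;> simp [a, b, hi, rotBlock_zero]
  obtain ⟨hV, -, hN, hAV⟩ := hJ
  refine isLocallyAsymptoticallyStable_of_modes (L := blockModes lam mu om)
    (κ := blockModes d a b) hrad hLip hA hxs htau ?_ ?_
  · rintro (i | i)
    · simp only [blockModes, Sum.elim_inl, d]
      rcases lt_or_gt_of_ne (hlam i) with hi | hi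
      · rw [if_neg (not_lt.2 hi.le), Complex.ofReal_zero]
        exact norm_modeMultiplier_zero_lt_one htau (by simpa using hi)
      · rw [if_pos hi, modeMultiplier_realGain htau hi, Complex.norm_real]
        exact hzeta i
    · simp only [blockModes, Sum.elim_inr, a, b]
      rcases lt_or_gt_of_ne (hmu i) with hi | hi
      · rw [if_neg (not_lt.2 hi.le), if_neg (not_lt.2 hi.le), Complex.ofReal_zero, zero_mul,
          add_zero]
        exact norm_modeMultiplier_zero_lt_one htau (by simpa using hi)
      · rw [if_pos hi, if_pos hi, modeMultiplier_complexGain htau hi, norm_mul,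
          Complex.norm_exp_ofReal_mul_I, Complex.norm_real, mul_one,
          Real.norm_of_nonneg (hrho i).1]
        exact (hrho i).2
  · intro η hη
    -- The scale `s = η⁻¹` bounds the coupling by `s⁻¹ = η`; the gain matrix has no coupling and
    -- stays exactly diagonal.
    refine ⟨(scaledCoords η⁻¹).comp (jordanCoords h V),
      (scaledCoords_injective (inv_ne_zero hη.ne')).comp (jordanCoords_injective h hV), ?_, ?_⟩
    · intro v
      rw [LinearMap.comp_apply, hgain, jordanCoords_conj_mulVec h hV,
        scaledCoords_blockDiag_mulVec]
      rfl
    · intro v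
      rw [LinearMap.comp_apply, hAV, jordanCoords_conj_mulVec h hV, Matrix.add_mulVec, map_add,
        scaledCoords_blockDiag_mulVec, LinearMap.comp_apply]
      have := hN.norm_scaledCoords_mulVec_le (inv_pos.2 hη) (jordanCoords h V v)
      rw [inv_inv] at this
      simpa [blockModes] using this

end TDFC

end

noncomputable section

namespace TDFC

/-! ### Existence of the real Jordan form -/

open Polynomial

/-- Decomposition of a finite-dimensional space under an endomorphism into cyclic subspaces of
prime power order. -/
theorem exists_cyclic_decomposition {k W : Type} [Field k] [AddCommGroup W] [Module k W]
    [FiniteDimensional k W] (T : Module.End k W) :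
    ∃ (ι : Type) (_ : Fintype ι) (q : ι → k[X]) (e : ι → ℕ) (g : ι → W),
      (∀ i, Irreducible (q i)) ∧ (∀ i, aeval T (q i ^ e i) (g i) = 0) ∧
      (∀ w, ∃ c : ι → k[X], w = ∑ i, aeval T (c i) (g i)) ∧
      ∑ i, e i * (q i).natDegree = Module.finrank k W := by
  classical
  obtain ⟨ι, hι, q, hq, e, ⟨Ψ⟩⟩ := Module.equiv_directSum_of_isTorsion
    (Module.AEval.isTorsion_of_finiteDimensional k W T)
  let one : ∀ i, k[X] ⧸ (Submodule.span k[X] {q i ^ e i}) := fun i => Submodule.Quotient.mk 1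
  let g : ι → Module.AEval k W T := fun i => Ψ.symm (DirectSum.lof k[X] ι _ i (one i))
  have hact : ∀ (c : k[X]) (w : Module.AEval k W T),
      (Module.AEval.of k W T).symm (c • w) = aeval T c ((Module.AEval.of k W T).symm w) :=
    fun c w => Module.AEval.of_symm_smul T c w
  refine ⟨ι, hι, q, e, fun i => (Module.AEval.of k W T).symm (g i), hq, fun i => ?_, fun w => ?_,
    ?_⟩
  · rw [← hact]
    have h1 : (q i ^ e i) • one i = 0 := by
      rw [← Submodule.Quotient.mk_smul, Submodule.Quotient.mk_eq_zero, smul_eq_mul, mul_one]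
      exact Submodule.mem_span_singleton_self _
    simp only [g]
    rw [← map_smul, ← map_smul, h1, map_zero, map_zero, map_zero]
  · have h1 : ∀ i, ∃ c : k[X], c • one i = (Ψ (Module.AEval.of k W T w)) i := by
      intro i
      obtain ⟨c, hc⟩ := Submodule.Quotient.mk_surjective _ ((Ψ (Module.AEval.of k W T w)) i)
      exact ⟨c, by rw [← hc, ← Submodule.Quotient.mk_smul, smul_eq_mul, mul_one]⟩
    choose c hc using h1
    refine ⟨c, ?_⟩
    have h2 : Ψ (Module.AEval.of k W T w) = ∑ i, c i • DirectSum.lof k[X] ι _ i (one i) := by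
      conv_lhs => rw [← DirectSum.sum_univ_of (Ψ (Module.AEval.of k W T w))]
      refine Finset.sum_congr rfl fun i _ => ?_
      rw [← map_smul, hc i]
      rfl
    apply (Module.AEval.of k W T).injective
    apply Ψ.injective
    rw [h2, map_sum, map_sum]
    refine Finset.sum_congr rfl fun i _ => ?_
    rw [← hact, LinearEquiv.apply_symm_apply, map_smul]
    simp only [g, LinearEquiv.apply_symm_apply]
  · have hne : ∀ i, q i ^ e i ≠ 0 := fun i => pow_ne_zero _ (hq i).ne_zero
    have hfr : ∀ i, Module.finrank k (k[X] ⧸ (Submodule.span k[X] {q i ^ e i})) =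
        e i * (q i).natDegree := by
      intro i
      have h1 : Module.finrank k (k[X] ⧸ Ideal.span {q i ^ e i}) = (q i ^ e i).natDegree :=
        finrank_quotient_span_eq_natDegree
      rw [natDegree_pow] at h1
      exact h1
    have hfin : ∀ i, Module.Finite k (k[X] ⧸ (Submodule.span k[X] {q i ^ e i})) := fun i =>
      (AdjoinRoot.powerBasis (hne i)).finite
    have h2 : Module.finrank k W =
        Module.finrank k (DirectSum ι fun i => k[X] ⧸ (Submodule.span k[X] {q i ^ e i})) :=
      ((Module.AEval.of k W T).trans (Ψ.restrictScalars k)).finrank_eq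
    rw [h2, Module.finrank_directSum]
    exact Finset.sum_congr rfl fun i _ => (hfr i).symm

/-- The irreducible real polynomials, up to constant factors. -/
theorem irreducible_real_classification {q : ℝ[X]} (hq : Irreducible q) :
    (∃ a : ℝ, Associated (X - C a) q) ∨
      ∃ a b : ℝ, b ≠ 0 ∧ Associated ((X - C a) ^ 2 + C (b ^ 2)) q := by
  have hassoc : ∀ s : ℝ[X], s ∣ q → ¬IsUnit s → Associated s q := fun s hs hu =>
    (associated_of_dvd_dvd hs ((hq.dvd_iff.1 hs).resolve_left hu).dvd)
  have hdeg : 0 < q.degree := hq.degree_pos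
  obtain ⟨z, hz⟩ := IsAlgClosed.exists_aeval_eq_zero ℂ q hdeg.ne'
  by_cases him : z.im = 0
  · left
    refine ⟨z.re, hassoc _ ?_ (irreducible_X_sub_C _).not_isUnit⟩
    rw [dvd_iff_isRoot, IsRoot.def]
    have h1 : z = algebraMap ℝ ℂ z.re := Complex.ext (by simp) (by simp [him])
    rw [h1, aeval_algebraMap_apply] at hz
    simpa using hz
  · right
    refine ⟨z.re, z.im, him, ?_⟩
    have h1 := quadratic_dvd_of_aeval_eq_zero_im_ne_zero q hz him
    have h2 : X ^ 2 - C (2 * z.re) * X + C (‖z‖ ^ 2) = (X - C z.re) ^ 2 + C (z.im ^ 2) := by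
      rw [Complex.sq_norm, Complex.normSq_apply]
      simp only [C_add, C_mul, C_pow, map_ofNat]
      ring
    rw [h2] at h1
    refine hassoc _ h1 fun hu => ?_
    have h3 : ((X - C z.re) ^ 2 + C (z.im ^ 2) : ℝ[X]).natDegree = 2 := by compute_degree!
    rw [natDegree_eq_zero_of_isUnit hu] at h3
    omega

/-- A subspace that contains all `c q ^ j g` with `j < e` and `deg c < deg q` contains the cyclic
subspace generated by `g`, if `q ^ e` annihilates `g`. -/
theorem aeval_apply_mem_of_forall_pow {k W : Type*} [Field k] [AddCommGroup W] [Module k W]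
    {T : Module.End k W} {q : k[X]} (hq : q.Monic) {e : ℕ} {g : W}
    (hg : aeval T (q ^ e) g = 0) {S : Submodule k W}
    (hS : ∀ j < e, ∀ c : k[X], c.degree < q.degree → aeval T (c * q ^ j) g ∈ S) (c : k[X]) :
    aeval T c g ∈ S := by
  -- Expansion of `c` in base `q`: each division by `q` splits off a digit of small degree, and the
  -- quotient moves to the next power until `q ^ e` kills the rest.
  have key : ∀ d j, j + d = e → ∀ c : k[X], aeval T (c * q ^ j) g ∈ S := by
    intro d
    induction d with
    | zero =>
      rintro j rfl c
      rw [map_mul, Module.End.mul_apply]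
      rw [add_zero] at hg
      rw [hg, map_zero]
      exact S.zero_mem
    | succ d ih =>
      intro j hj c
      have h1 : c * q ^ j = (c %ₘ q) * q ^ j + (c /ₘ q) * q ^ (j + 1) := by
        conv_lhs => rw [← modByMonic_add_div c q]
        ring
      rw [h1, map_add, LinearMap.add_apply]
      exact S.add_mem (hS j (by omega) _ (degree_modByMonic_lt c hq)) (ih (j + 1) (by omega) _)
  simpa using key e 0 (by omega) c

/-- The `b` are `n` vectors, so spanning alone makes the matrix `P` with these columns invertible
and independence need not be checked. The hypothesis on the columns says `A P = P D`; take `V =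
P⁻¹`. -/
theorem exists_jordan_of_spanning_columns {m p n : ℕ} (h : m + p * 2 = n)
    {A : Matrix (Fin n) (Fin n) ℝ} {lam : Fin m → ℝ} {mu om : Fin p → ℝ}
    {N : Matrix (BlockIndex m p) (BlockIndex m p) ℝ} (hom : ∀ i, om i ≠ 0)
    (hN : IsJordanOffDiag lam mu om N) (b : BlockIndex m p → Fin n → ℝ)
    (hspan : ∀ v, v ∈ Submodule.span ℝ (range b))
    (hcol : ∀ y, A.mulVec (b y) =
      ∑ x, (blockDiag lam (fun i => rotBlock (mu i) (om i)) + N) x y • b x) :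
    ∃ V, IsRealJordanDecomposition h A V lam mu om N := by
  set D := blockDiag lam (fun i => rotBlock (mu i) (om i)) + N with hD
  let P : Matrix (Fin n) (Fin n) ℝ := Matrix.of fun r c => b ((blockEquiv h).symm c) r
  have hP : IsUnit P := by
    rw [← Matrix.mulVec_surjective_iff_isUnit]
    intro v
    obtain ⟨c, hc⟩ := (Submodule.mem_span_range_iff_exists_fun ℝ).1 (hspan v)
    refine ⟨c ∘ (blockEquiv h).symm, ?_⟩
    rw [← hc]
    funext r
    simp only [Matrix.mulVec, dotProduct, P, Matrix.of_apply, Finset.sum_apply, Pi.smul_apply,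
      smul_eq_mul, Function.comp_apply]
    rw [← Equiv.sum_comp (blockEquiv h)]
    exact Finset.sum_congr rfl fun x _ => by simp [mul_comm]
  have hdet : IsUnit P.det := (Matrix.isUnit_iff_isUnit_det P).1 hP
  have hAP : A * P = P * Matrix.reindex (blockEquiv h) (blockEquiv h) D := by
    ext r c
    have h1 := congrFun (hcol ((blockEquiv h).symm c)) r
    simp only [Matrix.mulVec, dotProduct, Finset.sum_apply, Pi.smul_apply, smul_eq_mul] at h1
    simp only [Matrix.mul_apply, P, Matrix.of_apply, Matrix.reindex_apply, Matrix.submatrix_apply]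
    rw [h1, ← Equiv.sum_comp (blockEquiv h)]
    exact Finset.sum_congr rfl fun x _ => by simp [mul_comm]
  refine ⟨P⁻¹, (Matrix.isUnit_nonsing_inv_iff).2 hP, hom, hN, ?_⟩
  rw [Matrix.nonsing_inv_nonsing_inv _ hdet, ← hAP, Matrix.mul_nonsing_inv_cancel_right _ _ hdet]

end TDFC

end

noncomputable section

namespace TDFC

open Polynomial

/-! #### Chains in lexicographic order -/

section Chains

variable {k : ℕ} {s : Fin k → ℕ}

/-- The chain to which an index belongs, for `k` consecutive chains of lengths `s`. -/
def chainOf (x : Fin (∑ i, s i)) : Fin k := (finSigmaFinEquiv.symm x).1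

/-- The position of an index in its chain. -/
def chainPos (x : Fin (∑ i, s i)) : ℕ := (finSigmaFinEquiv.symm x).2

theorem chainPos_lt (x : Fin (∑ i, s i)) : chainPos x < s (chainOf x) :=
  (finSigmaFinEquiv.symm x).2.2

theorem val_eq_add_chainPos (x : Fin (∑ i, s i)) :
    (x : ℕ) = ∑ i : Fin (chainOf x), s (Fin.castLE (chainOf x).2.le i) + chainPos x := by
  have := finSigmaFinEquiv_apply (finSigmaFinEquiv.symm x)
  rwa [Equiv.apply_symm_apply] at this

theorem exists_chainOf_eq (i : Fin k) {j : ℕ} (hj : j < s i) :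
    ∃ x : Fin (∑ i, s i), chainOf x = i ∧ chainPos x = j :=
  ⟨finSigmaFinEquiv ⟨i, j, hj⟩, by simp [chainOf], by
    simp only [chainPos]
    rw [Equiv.symm_apply_apply]⟩

/-- Index minus position is constant along a chain, written additively to avoid truncated
subtraction. -/
theorem val_sub_chainPos_eq {x y : Fin (∑ i, s i)} (h : chainOf x = chainOf y) :
    (x : ℕ) + chainPos y = y + chainPos x := by
  have hx := val_eq_add_chainPos x
  have hy := val_eq_add_chainPos y
  rw [h] at hx
  omega

/-- The sum is the contribution of the superdiagonal coupling to column `y`: it selects the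
predecessor of `y` in its chain, and the first element has none. -/
theorem sum_pred_eq_zero {W : Type*} [AddCommGroup W] [Module ℝ W] (F : Fin (∑ i, s i) → W)
    {y : Fin (∑ i, s i)} (hy : chainPos y = 0) :
    ∑ x : Fin (∑ i, s i),
        (if (x : ℕ) + 1 = y ∧ chainOf x = chainOf y then (1 : ℝ) else 0) • F x = 0 := by
  refine Finset.sum_eq_zero fun x _ => ?_
  rw [if_neg, zero_smul]
  rintro ⟨h1, h2⟩
  have := val_sub_chainPos_eq h2
  omega

theorem exists_sum_pred_eq {W : Type*} [AddCommGroup W] [Module ℝ W] (F : Fin (∑ i, s i) → W)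
    {y : Fin (∑ i, s i)} {j : ℕ} (hy : chainPos y = j + 1) :
    ∃ z, chainOf z = chainOf y ∧ chainPos z = j ∧
      ∑ x : Fin (∑ i, s i),
        (if (x : ℕ) + 1 = y ∧ chainOf x = chainOf y then (1 : ℝ) else 0) • F x = F z := by
  obtain ⟨z, hz1, hz2⟩ := exists_chainOf_eq (s := s) (chainOf y) (j := j) (by
    have := chainPos_lt y
    omega)
  have hz := val_sub_chainPos_eq hz1
  refine ⟨z, hz1, hz2, ?_⟩
  rw [Finset.sum_eq_single z, if_pos ⟨by omega, hz1⟩, one_smul]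
  · intro x _ hx
    rw [if_neg, zero_smul]
    rintro ⟨h1, -⟩
    exact hx (Fin.ext (by omega))
  · simp

end Chains

/-! ### Real cyclic summands and the Jordan basis -/

/-- Real form of the cyclic decomposition: `kr` chains for real eigenvalues and `kc` chains for
pairs of non-real ones. -/
theorem exists_real_cyclic_decomposition {W : Type} [AddCommGroup W] [Module ℝ W]
    [FiniteDimensional ℝ W] (T : Module.End ℝ W) :
    ∃ (kr kc : ℕ) (lr : Fin kr → ℝ) (er : Fin kr → ℕ) (gr : Fin kr → W) (mc oc : Fin kc → ℝ)
      (ec : Fin kc → ℕ) (gc : Fin kc → W), (∀ i, oc i ≠ 0) ∧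
      (∀ i, aeval T ((X - C (lr i)) ^ er i) (gr i) = 0) ∧
      (∀ i, aeval T (((X - C (mc i)) ^ 2 + C (oc i ^ 2)) ^ ec i) (gc i) = 0) ∧
      (∀ w, ∃ (c : Fin kr → ℝ[X]) (d : Fin kc → ℝ[X]),
        w = ∑ i, aeval T (c i) (gr i) + ∑ i, aeval T (d i) (gc i)) ∧
      ∑ i, er i + (∑ i, ec i) * 2 = Module.finrank ℝ W := by
  classical
  obtain ⟨ι, hι, q, e, g, hq, hg, hspan, hdim⟩ := exists_cyclic_decomposition T
  have hass : ∀ {s q : ℝ[X]} {e : ℕ} {g : W}, Associated s q → aeval T (q ^ e) g = 0 →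
      aeval T (s ^ e) g = 0 := by
    intro s q e g h h0
    obtain ⟨c, hc⟩ := (h.pow_pow (n := e)).symm.dvd
    rw [hc, mul_comm, map_mul, Module.End.mul_apply, h0, map_zero]
  let p : ι → Prop := fun i => ∃ a : ℝ, Associated (X - C a) (q i)
  have hr : ∀ i : {i // p i}, ∃ a : ℝ, Associated (X - C a) (q i) := fun i => i.2
  have hc : ∀ i : {i // ¬p i}, ∃ ab : ℝ × ℝ, ab.2 ≠ 0 ∧
      Associated ((X - C ab.1) ^ 2 + C (ab.2 ^ 2)) (q i) := fun i => by
    obtain ⟨a, b, hb, h⟩ := (irreducible_real_classification (hq i)).resolve_left i.2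
    exact ⟨(a, b), hb, h⟩
  choose a ha using hr
  choose ab hab0 hab using hc
  let φ := (Fintype.equivFin {i // p i}).symm
  let ψ := (Fintype.equivFin {i // ¬p i}).symm
  refine ⟨_, _, a ∘ φ, fun i => e (φ i), fun i => g (φ i), fun i => (ab (ψ i)).1,
    fun i => (ab (ψ i)).2, fun i => e (ψ i), fun i => g (ψ i), fun i => hab0 _,
    fun i => hass (ha _) (hg _), fun i => hass (hab _) (hg _), fun w => ?_, ?_⟩
  · obtain ⟨c, hc⟩ := hspan w
    refine ⟨fun i => c (φ i), fun i => c (ψ i), ?_⟩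
    rw [hc, Equiv.sum_comp φ fun i => aeval T (c i) (g i),
      Equiv.sum_comp ψ fun i => aeval T (c i) (g i)]
    exact (Fintype.sum_subtype_add_sum_subtype p fun i => aeval T (c i) (g i)).symm
  · rw [Equiv.sum_comp φ fun i => e i, Equiv.sum_comp ψ fun i => e i, ← hdim,
      ← Fintype.sum_subtype_add_sum_subtype p fun i => e i * (q i).natDegree, Finset.sum_mul]
    congr 1
    · refine Finset.sum_congr rfl fun i _ => ?_
      rw [← natDegree_eq_of_degree_eq (degree_eq_degree_of_associated (ha i)), natDegree_X_sub_C,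
        mul_one]
    · refine Finset.sum_congr rfl fun i _ => ?_
      rw [← natDegree_eq_of_degree_eq (degree_eq_degree_of_associated (hab i))]
      congr 1
      symm
      compute_degree!

/-- Every real matrix has a real Jordan decomposition. -/
theorem exists_isRealJordanDecomposition {n : ℕ} (A : Matrix (Fin n) (Fin n) ℝ) :
    ∃ (m p : ℕ) (h : m + p * 2 = n) (V : Matrix (Fin n) (Fin n) ℝ)
      (lam : Fin m → ℝ) (mu om : Fin p → ℝ) (N : Matrix (BlockIndex m p) (BlockIndex m p) ℝ),
      IsRealJordanDecomposition h A V lam mu om N := by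
  let T : Module.End ℝ (Fin n → ℝ) := A.mulVecLin
  obtain ⟨kr, kc, lr, er, gr, mc, oc, ec, gc, hoc, hgr, hgc, hspan, hdim⟩ :=
    exists_real_cyclic_decomposition T
  rw [Module.finrank_fin_fun] at hdim
  let Q : Fin kc → ℝ[X] := fun i => (X - C (mc i)) ^ 2 + C (oc i ^ 2)
  -- With `σ = -1/ω` and `v' = σ (T - μ) v` one gets `T v = μ v - ω v'` and `T v' = μ v' + ω v + σ
  -- Q(T) v`. The first terms are the rotation block for the basis `v', v`; the last one is the
  -- predecessor of `v` if chains advance by `σ Q`. Hence the coupling by a single `1`.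
  let σ : Fin kc → ℝ := fun i => -(oc i)⁻¹
  have hσ : ∀ i, σ i ≠ 0 := fun i => neg_ne_zero.2 (inv_ne_zero (hoc i))
  have hσo : ∀ i, σ i * oc i = -1 := fun i => by
    have := hoc i
    simp only [σ]; field_simp
  have haev : ∀ (c d : ℝ[X]) (w : Fin n → ℝ), aeval T (c * d) w = aeval T c (aeval T d w) :=
    fun c d w => by rw [map_mul, Module.End.mul_apply]
  -- Exponents decrease along the chain, so position `0` is the eigenvector and `T - λ` maps each
  -- vector to its predecessor.
  let vr : Fin (∑ i, er i) → Fin n → ℝ := fun x =>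
    aeval T ((X - C (lr (chainOf x))) ^ (er (chainOf x) - 1 - chainPos x)) (gr (chainOf x))
  let vc : Fin (∑ i, ec i) → Fin n → ℝ := fun x =>
    aeval T ((C (σ (chainOf x)) * Q (chainOf x)) ^ (ec (chainOf x) - 1 - chainPos x))
      (gc (chainOf x))
  let vc' : Fin (∑ i, ec i) → Fin n → ℝ := fun x =>
    aeval T (C (σ (chainOf x)) * (X - C (mc (chainOf x)))) (vc x)
  let b : BlockIndex (∑ i, er i) (∑ i, ec i) → Fin n → ℝ :=
    Sum.elim vr fun r => if r.2 = 0 then vc' r.1 else vc r.1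
  let N : Matrix (BlockIndex (∑ i, er i) (∑ i, ec i)) (BlockIndex (∑ i, er i) (∑ i, ec i)) ℝ :=
    Matrix.fromBlocks
      (Matrix.of fun x y => if (x : ℕ) + 1 = y ∧ chainOf x = chainOf y then 1 else 0) 0 0
      (Matrix.of fun x y => if (x.1 : ℕ) + 1 = y.1 ∧ chainOf x.1 = chainOf y.1 then
        (!![0, 0; 1, 0] : Matrix (Fin 2) (Fin 2) ℝ) x.2 y.2 else 0)
  let lam : Fin (∑ i, er i) → ℝ := fun x => lr (chainOf x)
  let mu : Fin (∑ i, ec i) → ℝ := fun x => mc (chainOf x)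
  let om : Fin (∑ i, ec i) → ℝ := fun x => oc (chainOf x)
  have hN : IsJordanOffDiag lam mu om N := by
    refine ⟨fun i j => ?_, fun i r => ⟨rfl, rfl⟩, fun i j => ?_⟩
    · simp only [N, Matrix.fromBlocks_apply₁₁, Matrix.of_apply]
      by_cases hij : (i : ℕ) + 1 = j ∧ chainOf i = chainOf j
      · exact Or.inr ⟨hij.1, congrArg lr hij.2, if_pos hij⟩
      · exact Or.inl (if_neg hij)
    · simp only [N, Matrix.fromBlocks_apply₂₂, Matrix.of_apply]
      by_cases hij : (i : ℕ) + 1 = j ∧ chainOf i = chainOf j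
      · refine Or.inr ⟨hij.1, congrArg mc hij.2, congrArg oc hij.2, Or.inr ?_⟩
        ext a b
        simp [hij]
      · left
        ext a b
        simp [hij]
  have hvr : ∀ y, T (vr y) = lam y • vr y +
      ∑ x : Fin (∑ i, er i),
        (if (x : ℕ) + 1 = y ∧ chainOf x = chainOf y then (1 : ℝ) else 0) • vr x := by
    intro y
    have h1 : T (vr y) = lam y • vr y + aeval T (X - C (lam y)) (vr y) := by
      simp [Module.algebraMap_end_apply]
    rw [h1]
    congr 1
    simp only [vr, lam]
    rw [← haev, ← pow_succ']
    have hlt := chainPos_lt y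
    rcases hy : chainPos y with _ | j
    · rw [sum_pred_eq_zero _ hy, ← hgr (chainOf y)]
      congr 3
      omega
    · obtain ⟨z, hz1, hz2, hz3⟩ := exists_sum_pred_eq vr hy
      refine Eq.trans ?_ hz3.symm
      simp only [vr, hz1, hz2]
      congr 3
      omega
  have hvc : ∀ y, T (vc y) = mu y • vc y - om y • vc' y := by
    intro y
    have h1 : X = C (mu y) - C (om y) * (C (σ (chainOf y)) * (X - C (mu y))) := by
      have h2 : C (σ (chainOf y)) * C (om y) = (-1 : ℝ[X]) := by
        rw [← C_mul, hσo]; simp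
      linear_combination (X - C (mu y)) * h2
    have h3 : T (vc y) = aeval T (X : ℝ[X]) (vc y) := by simp
    rw [h3, h1, map_sub, LinearMap.sub_apply, haev (C (om y))]
    simp [vc', mu, Module.algebraMap_end_apply]
    exact smul_comm _ _ _
  have hvc' : ∀ y, T (vc' y) = mu y • vc' y + om y • vc y +
      ∑ x : Fin (∑ i, ec i),
        (if (x : ℕ) + 1 = y ∧ chainOf x = chainOf y then (1 : ℝ) else 0) • vc x := by
    intro y
    have h1 : X * (C (σ (chainOf y)) * (X - C (mu y))) =
        C (mu y) * (C (σ (chainOf y)) * (X - C (mu y))) + C (om y) +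
          C (σ (chainOf y)) * Q (chainOf y) := by
      have h2 : C (σ (chainOf y)) * C (om y) = (-1 : ℝ[X]) := by
        rw [← C_mul, hσo]; simp
      simp only [Q]
      rw [C_pow]
      change X * (C (σ (chainOf y)) * (X - C (mu y))) =
        C (mu y) * (C (σ (chainOf y)) * (X - C (mu y))) + C (om y) +
          C (σ (chainOf y)) * ((X - C (mu y)) ^ 2 + C (om y) ^ 2)
      linear_combination -C (om y) * h2
    have h3 : T (vc' y) = aeval T (X * (C (σ (chainOf y)) * (X - C (mu y)))) (vc y) := by
      rw [haev X]; simp [vc', mu]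
    rw [h3, h1, map_add, map_add, LinearMap.add_apply, LinearMap.add_apply, haev (C (mu y))]
    congr 1
    · simp [vc', mu, Module.algebraMap_end_apply]
      exact smul_comm _ _ _
    · simp only [vc]
      rw [← haev, ← pow_succ']
      have hlt := chainPos_lt y
      rcases hy : chainPos y with _ | j
      · rw [sum_pred_eq_zero _ hy]
        have h4 : ec (chainOf y) - 1 - 0 + 1 = ec (chainOf y) := by omega
        rw [h4, mul_pow, haev, hgc, map_zero]
      · obtain ⟨z, hz1, hz2, hz3⟩ := exists_sum_pred_eq vc hy
        refine Eq.trans ?_ hz3.symm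
        simp only [vc, hz1, hz2]
        congr 3
        omega
  have hb : ∀ x, b x ∈ Submodule.span ℝ (range b) := fun x =>
    Submodule.subset_span (mem_range_self x)
  have hr_mem : ∀ (i : Fin kr) (c : ℝ[X]), aeval T c (gr i) ∈ Submodule.span ℝ (range b) := by
    intro i
    refine aeval_apply_mem_of_forall_pow (monic_X_sub_C (lr i)) (hgr i) fun j hj c hc => ?_
    rw [degree_X_sub_C] at hc
    rw [eq_C_of_degree_le_zero (Nat.WithBot.lt_one_iff_le_zero.1 hc), haev]
    obtain ⟨x, rfl, hx⟩ := exists_chainOf_eq (s := er) i (j := er i - 1 - j) (by omega)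
    have h1 : aeval T ((X - C (lr (chainOf x))) ^ j) (gr (chainOf x)) = b (Sum.inl x) := by
      simp only [b, vr, Sum.elim_inl, hx]
      congr 3
      omega
    rw [h1, aeval_C, Module.algebraMap_end_apply]
    exact Submodule.smul_mem _ _ (hb _)
  have hc_mem : ∀ (i : Fin kc) (c : ℝ[X]), aeval T c (gc i) ∈ Submodule.span ℝ (range b) := by
    intro i
    have hQd : (Q i).degree = 2 := by simp only [Q]; compute_degree!
    have hQm : (Q i).Monic := by simp only [Q]; monicity!
    refine aeval_apply_mem_of_forall_pow hQm (hgc i) fun j hj c hc => ?_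
    rw [hQd] at hc
    obtain ⟨c₁, c₀, rfl⟩ := exists_eq_X_add_C_of_natDegree_le_one
      (natDegree_le_iff_coeff_eq_zero.2 ((degree_lt_iff_coeff_zero c 2).1 hc))
    obtain ⟨x, rfl, hx⟩ := exists_chainOf_eq (s := ec) i (j := ec i - 1 - j) (by omega)
    set i := chainOf x with hi
    have hvcx : vc x = aeval T ((C (σ i) * Q i) ^ j) (gc i) := by
      simp only [vc, hx, ← hi]
      congr 3
      omega
    have h0 : C (σ i)⁻¹ * C (σ i) = (1 : ℝ[X]) := by rw [← C_mul, inv_mul_cancel₀ (hσ i), C_1]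
    -- A digit of degree at most one is rewritten through `1` and `σ (X - μ)`, which produce `vc`
    -- and `vc'`, and `Q ^ j` as `σ⁻ʲ (σ Q) ^ j`.
    have h1 : (C c₁ * X + C c₀) * Q i ^ j =
        C ((c₁ * mc i + c₀) * (σ i)⁻¹ ^ j) * (C (σ i) * Q i) ^ j +
        C (c₁ * (σ i)⁻¹ * (σ i)⁻¹ ^ j) *
          (C (σ i) * (X - C (mc i)) * (C (σ i) * Q i) ^ j) := by
      have h2 : C (σ i)⁻¹ ^ j * (C (σ i) * Q i) ^ j = Q i ^ j := by
        rw [← mul_pow, ← mul_assoc, h0, one_mul]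
      simp only [C_mul, C_add, C_pow]
      linear_combination (-(C c₁ * X + C c₀)) * h2 -
        C c₁ * (X - C (mc i)) * (C (σ i)⁻¹ ^ j * (C (σ i) * Q i) ^ j) * h0
    rw [h1, map_add, LinearMap.add_apply, haev, haev (C (c₁ * _ * _)), haev (C (σ i) * _),
      ← hvcx, aeval_C, aeval_C, Module.algebraMap_end_apply, Module.algebraMap_end_apply]
    exact Submodule.add_mem _ (Submodule.smul_mem _ _ (hb (Sum.inr (x, 1))))
      (Submodule.smul_mem _ _ (hb (Sum.inr (x, 0))))
  obtain ⟨V, hV⟩ := exists_jordan_of_spanning_columns (A := A) hdim (fun i => hoc _) hN b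
    (fun v => by
      obtain ⟨c, d, rfl⟩ := hspan v
      exact Submodule.add_mem _ (Submodule.sum_mem _ fun i _ => hr_mem i _)
        (Submodule.sum_mem _ fun i _ => hc_mem i _))
    (fun y => by
      have hTA : A.mulVec (b y) = T (b y) := rfl
      rw [hTA]
      rcases y with y | ⟨y, a⟩
      · have h1 : T (b (Sum.inl y)) = _ := hvr y
        rw [h1]
        simp [Fintype.sum_sum_type, blockDiag, N, b, add_smul, Finset.sum_add_distrib,
          Matrix.diagonal_apply]
      · fin_cases a
        · have h1 : T (b (Sum.inr (y, 0))) = _ := hvc' y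
          refine h1.trans ?_
          simp [Fintype.sum_sum_type, Fintype.sum_prod_type, blockDiag, N, b, add_smul,
            Finset.sum_add_distrib, rotBlock]
          rfl
        · have h1 : T (b (Sum.inr (y, 1))) = _ := hvc y
          refine (h1.trans (sub_eq_neg_add _ _)).trans ?_
          simp [Fintype.sum_sum_type, Fintype.sum_prod_type, blockDiag, N, b, add_smul,
            Finset.sum_add_distrib, rotBlock]
          rfl)
  exact ⟨_, _, hdim, V, lam, mu, om, N, hV⟩

end TDFC

end

theorem mainTheorem1 (n : ℕ) (f : (Fin n → ℝ) → (Fin n → ℝ)) (xs : Fin n → ℝ)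
    (A : Matrix (Fin n) (Fin n) ℝ)
    (hf : TDFC.PiecewiseC1At f xs) (hA : TDFC.IsJacobianAt f A xs)
    (hxs : f xs = 0) (hhyp : TDFC.IsHyperbolic A) :
    (∃ (m p : ℕ) (h : m + p * 2 = n) (V : Matrix (Fin n) (Fin n) ℝ)
      (lam : Fin m → ℝ) (mu om : Fin p → ℝ)
      (N : Matrix (TDFC.BlockIndex m p) (TDFC.BlockIndex m p) ℝ),
      TDFC.IsRealJordanDecomposition h A V lam mu om N) ∧
    ∀ (m p : ℕ) (h : m + p * 2 = n) (V : Matrix (Fin n) (Fin n) ℝ)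
      (lam : Fin m → ℝ) (mu om : Fin p → ℝ)
      (N : Matrix (TDFC.BlockIndex m p) (TDFC.BlockIndex m p) ℝ),
      TDFC.IsRealJordanDecomposition h A V lam mu om N →
      ∀ (tau : ℝ), 0 < tau →
      ∀ (zeta : Fin m → ℝ), (∀ i, |zeta i| < 1) →
      ∀ (rho theta : Fin p → ℝ), (∀ i, 0 ≤ rho i ∧ rho i < 1) →
        (∀ i, 0 ≤ theta i ∧ theta i < 2 * Real.pi) →
      TDFC.IsLocallyAsymptoticallyStable f tau
        (V⁻¹ * TDFC.gainTilde h tau lam mu om zeta rho theta * V) xs := by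
  exact ⟨TDFC.exists_isRealJordanDecomposition A,
    fun _ _ _ _ _ _ _ _ hJ _ htau _ hzeta _ _ hrho _ =>
      hJ.isLocallyAsymptoticallyStable hf hA hxs hhyp htau hzeta hrho⟩
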